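/- Let $n\ge 1$, let $\Omega=\begin{pmatrix}0&I_n\\-I_n&0\end{pmatrix}$ and $C(X,Y)=X\Omega Y^T$ for row vectors $X,Y\in\mathbb C^{2n}$, and let $Sp(2n,\mathbb C)$ be the group of matrices preserving $C$. A $C_n$-vector on an open set $X\subseteq\mathbb R$ is a smooth vector $F=(f_0,\dots,f_{2n-1}):X\to\mathbb C^{2n}$ such that $$C(F^{(i)},F^{(i+1)})=0\quad(0\le i\le n-2),\qquad C(F^{(n-1)},F^{(n)})=-1 .$$ (1) Let $F(x)$ and $G(y)$ be $C_n$-vectors on open sets $X,Y\subseteq\mathbb R$, and for $i\ge 1$ put $$\tau_i(x,y)=\det\big(F^{(j)}(x)\cdot G^{(k)}(y)\big)_{j,k=0}^{i-1},\qquad F\cdot G=\sum_{l=0}^{2n-1}f_l g_l .$$ Then on every open set $W\subseteq X\times Y$ on which $\tau_1,\dots,\tau_n$ have no zeros and continuous branches $u_i=-\log\tau_i$ $(1\le i\le n)$ are given, the $u_i$ are smooth and satisfy the $C_n$ Toda field equations $$u_{i,xy}=-\exp\Big(\sum_{j=1}^n a_{ij}u_j\Big),\qquad 1\le i\le n,$$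 where $(a_{ij})$ is the Cartan matrix of type $C_n$: $a_{ii}=2$, $a_{n,n-1}=-2$, $a_{ij}=-1$ for all other $i,j$ with $|i-j|=1$, and $a_{ij}=0$ otherwise. (2) Given functions $\phi_1,\dots,\phi_n$ on an interval containing $0$, let $$\mathcal I(a_1\cdots a_k)(x)=\int_0^x\phi_{a_1}(x_1)\,dx_1\int_0^{x_1}\phi_{a_2}(x_2)\,dx_2\cdots\int_0^{x_{k-1}}\phi_{a_k}(x_k)\,dx_k,\qquad \mathcal I(\varnothing)=1 .$$ Write $\mathcal I(1\to i)$ for the sequence $1,2,\dots,i$ (empty for $i=0$) and $\mathcal I(1\to n\to j)$ for the sequence $1,2,\dots,n-1,n,n-1,\dots,j$ (which is $1,\dots,n$ for $j=n$). For smooth $\phi_1,\dots,\phi_n:X\to\mathbb C\setminus\{0\}$ on an open interval $X\ni 0$ and a continuous square root $\sqrt{\phi_n}$, put $$p=\frac1{\phi_1\cdots\phi_{n-1}\sqrt{\phi_n}},\qquad f_i=(-1)^{n-i}\,p\,\mathcal I(1\to i)\ (0\le i\le n-1),$$ $$f_i=p\,\mathcal I(1\to n\to (i-n+1))\ (n\le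 i\le 2n-2),\qquad f_{2n-1}=p\,\mathcal I(1\to n).$$ Then $F=(f_0,\dots,f_{2n-1})$ is a $C_n$-vector on $X$. Moreover, this is the most general $C_n$-vector, locally and up to a constant symplectic transformation: if $F$ is any $C_n$-vector on an open set $X\ni 0$, then there are an open interval $X'$ with $0\in X'\subseteq X$, smooth functions $\phi_1,\dots,\phi_n:X'\to\mathbb C\setminus\{0\}$ with a continuous square root $\sqrt{\phi_n}$, and a matrix $S\in Sp(2n,\mathbb C)$, such that $F=(f_0,\dots,f_{2n-1})\,S$ on $X'$ with the $f_i$ above. -/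

import Mathlib

open scoped ContDiff Matrix

noncomputable section

namespace CnToda

/-- Index set of vectors of length `2n`: `Sum.inl i` is the coordinate number `i` and `Sum.inr i`
the coordinate number `n + i`, for `0 ≤ i ≤ n - 1`. -/
abbrev Idx (n : ℕ) : Type := Fin n ⊕ Fin n

/-- The skew-symmetric matrix `Ω = (0, I; -I, 0)` (the negative of Mathlib's `Matrix.J`, hence with
the same symplectic group). -/
def Omega (n : ℕ) : Matrix (Idx n) (Idx n) ℂ :=
  Matrix.fromBlocks 0 1 (-1) 0

/-- The symplectic form `C(X, Y) = X Ω Yᵀ` on row vectors. -/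
def symp {n : ℕ} (X Y : Idx n → ℂ) : ℂ :=
  X ⬝ᵥ (Omega n *ᵥ Y)

/-- `F` is a smooth vector of `2n` functions on `X` such that `C(F^{(i)}, F^{(i+1)}) = 0` for
`0 ≤ i ≤ n - 2` and `C(F^{(n-1)}, F^{(n)}) = -1`. -/
structure IsCnVector (n : ℕ) (X : Set ℝ) (F : ℝ → Idx n → ℂ) : Prop where
  smooth : ContDiffOn ℝ ∞ F X
  symp_eq_zero : ∀ i : ℕ, i + 2 ≤ n → ∀ x ∈ X,
    symp (iteratedDeriv i F x) (iteratedDeriv (i + 1) F x) = 0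
  symp_eq_neg_one : ∀ x ∈ X,
    symp (iteratedDeriv (n - 1) F x) (iteratedDeriv n F x) = -1

/-- `τ_{i,F,G}(x, y)`, the determinant of the `i × i` matrix with entries
`∂_x^j ∂_y^k (F · G) = F^{(j)}(x) · G^{(k)}(y)`, `0 ≤ j, k ≤ i - 1`. -/
def tau {n : ℕ} (F G : ℝ → Idx n → ℂ) (i : ℕ) (x y : ℝ) : ℂ :=
  Matrix.det (Matrix.of fun j k : Fin i =>
    iteratedDeriv (j : ℕ) F x ⬝ᵥ iteratedDeriv (k : ℕ) G y)

/-- `u` is a continuous branch of `-log τ` on the set `W` of the `(x, y)`-plane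
(in particular `τ` has no zero in `W`). -/
def IsNegLog (W : Set (ℝ × ℝ)) (u t : ℝ → ℝ → ℂ) : Prop :=
  ContinuousOn (Function.uncurry u) W ∧ ∀ x y, (x, y) ∈ W → Complex.exp (-u x y) = t x y

/-- The functions `u_i` are smooth on `W` and satisfy there the Toda field equations
`u_{i,xy} = -exp (∑ j, a_{ij} u_j)` with coefficient matrix `A`. -/
def IsTodaSolution {n : ℕ} (A : Matrix (Fin n) (Fin n) ℤ) (W : Set (ℝ × ℝ))
    (u : Fin n → ℝ → ℝ → ℂ) : Prop :=
  (∀ i, ContDiffOn ℝ ∞ (Function.uncurry (u i)) W) ∧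
    ∀ i x y, (x, y) ∈ W →
      deriv (fun y' => deriv (fun x' => u i x' y') x) y =
        -Complex.exp (∑ j, (A i j : ℂ) * u j x y)

/-- The iterated integral
`I(a₁ ⋯ a_k)(x) = ∫_0^x φ_{a₁}(x₁) dx₁ ∫_0^{x₁} φ_{a₂}(x₂) dx₂ ⋯ ∫_0^{x_{k-1}} φ_{a_k}(x_k) dx_k`,
with `I(∅) = 1`. -/
def iterInt (φ : ℕ → ℝ → ℂ) : List ℕ → ℝ → ℂ
  | [] => fun _ => 1
  | a :: l => fun x => ∫ t in (0 : ℝ)..x, φ a t * iterInt φ l t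

/-- The increasing sequence `1, 2, …, i` (empty for `i = 0`). -/
def seqUp (i : ℕ) : List ℕ := List.range' 1 i

/-- The sequence `1, 2, …, n - 1, n, n - 1, …, j + 1, j` for `1 ≤ j ≤ n`; for `j = n` it is
`1, 2, …, n`. -/
def seqUpDown (n j : ℕ) : List ℕ := List.range' 1 n ++ (List.range' j (n - j)).reverse

/-- `φ_1, …, φ_n` are smooth functions without zeros on `X` and `r` is a continuous square root
of `φ_n` on `X`. -/
structure IsLeznovData (n : ℕ) (X : Set ℝ) (φ : ℕ → ℝ → ℂ) (r : ℝ → ℂ) : Prop where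
  smooth : ∀ k, 1 ≤ k → k ≤ n → ContDiffOn ℝ ∞ (φ k) X
  ne_zero : ∀ k, 1 ≤ k → k ≤ n → ∀ x ∈ X, φ k x ≠ 0
  sqrt_continuous : ContinuousOn r X
  sqrt_sq : ∀ x ∈ X, r x ^ 2 = φ n x

/-- The prefactor `p = 1 / (φ_1 ⋯ φ_{n-1} √φ_n)`, where `r = √φ_n`. -/
def prefactor (n : ℕ) (φ : ℕ → ℝ → ℂ) (r : ℝ → ℂ) (x : ℝ) : ℂ :=
  1 / ((∏ k ∈ Finset.Ico 1 n, φ k x) * r x)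

/-- Leznov's vector: `f_i = (-1)^{n-i} p I(1 → i)` for `0 ≤ i ≤ n - 1` and
`f_{n+i} = p I(1 → n → i + 1)` for `0 ≤ i ≤ n - 1`; in particular `f_{2n-1} = p I(1 → n)`. -/
def leznov (n : ℕ) (φ : ℕ → ℝ → ℂ) (r : ℝ → ℂ) (x : ℝ) : Idx n → ℂ :=
  Sum.elim
    (fun i => (-1) ^ (n - (i : ℕ)) * prefactor n φ r x * iterInt φ (seqUp i) x)
    (fun i => prefactor n φ r x * iterInt φ (seqUpDown n (i + 1)) x)

end CnToda

end

/-!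
The pairings `c_{ij} = C(F^{(i)}, F^{(j)})` satisfy `c_{ij}' = c_{i+1,j} + c_{i,j+1}`. Hence the
defining conditions of a `C_n`-vector propagate: `c_{ij} = 0` for `i + j < 2n - 1`, and
`c_{ij} = (-1)^{n+i}` for `i + j = 2n - 1` (`IsCnVector.symp_eq_zero_of_add_lt`,
`IsCnVector.symp_of_add_eq`).

*Toda equations.* Differentiating `τ_i` in `x` or `y` only changes its last row or column, so the
Desnanot–Jacobi identity (`exists_schur`) gives `∂_x∂_y (-log τ_i) = -τ_{i-1} τ_{i+1} / τ_i²`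
(`deriv_deriv_negLog_tau`). For `i < n` this is the Toda equation; for `i = n` one needs
`τ_{n+1} = τ_{n-1}` (`det_dotProduct_succ_eq_pred`). Let `R_m` consist of the first `m` vectors
`F^{(j)}` and of the symplectic duals of the last vectors in the sequence `G^{(k)}`. Multiplying
`R_m` by the `G^{(k)}`, or by the duals of the `F^{(j)}`, produces block triangular matrices of
determinants `τ_m` and `τ_{2n-m}`. So `τ_m` and `τ_{2n-m}` are proportional with a factor
independent of `m`, and the factor is `1` because `τ_n ≠ 0`.

*Leznov's vectors.* Put `ψ_k = φ_{min(k, 2n-k)}`. Up to order and signs, Leznov's vector is `p H_0`,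
where the vectors of iterated integrals `H_i` (`flagVec`) satisfy `H_i' = ψ_{i+1} H_{i+1}`. The
symmetry of `ψ` makes all pairings `C(H_i, H_j)` constant (`symp_flagVec_of_add_lt`), and the
derivatives of `p H_0` are triangular combinations of the `H_i` (`exists_triangular`).

*Generality.* Choose a symplectic matrix `S` whose first `n` rows are `F^{(i)}(0)`, `i < n`
(`IsCnVector.exists_symplectic`). The coordinates of `F S⁻¹`, suitably ordered, then vanish at `0`
to order exactly `0, 1, …, 2n - 1`. Dividing by the first one, differentiating and repeating writes
them as iterated integrals of nonvanishing functions `ψ_1, …, ψ_{2n-1}` times a common factor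
(`exists_iterInt_of_vanishing_order`). Vanishing of the pairings forces `ψ_k = ψ_{2n-k}`, and
`C(F^{(n-1)}, F^{(n)}) = -1` forces the common factor to be Leznov's prefactor
(`IsCnVector.exists_eq_leznov`).
-/

namespace CnToda

/-! ### Chains of derivatives -/

section Chains

variable {E : Type*} [NormedAddCommGroup E] [NormedSpace ℝ E]

theorem contDiffOn_iteratedDeriv {X : Set ℝ} {F : ℝ → E} (hX : IsOpen X)
    (hF : ContDiffOn ℝ ∞ F X) (i : ℕ) : ContDiffOn ℝ ∞ (iteratedDeriv i F) X := by
  induction i with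
  | zero => simpa using hF
  | succ i ih =>
    rw [iteratedDeriv_succ]
    exact ((contDiffOn_infty_iff_deriv_of_isOpen hX).1 ih).2

theorem hasDerivAt_iteratedDeriv {X : Set ℝ} {F : ℝ → E} (hX : IsOpen X)
    (hF : ContDiffOn ℝ ∞ F X) (i : ℕ) {x : ℝ} (hx : x ∈ X) :
    HasDerivAt (iteratedDeriv i F) (iteratedDeriv (i + 1) F x) x := by
  have h : ContDiffOn ℝ ∞ (iteratedDeriv i F) X := contDiffOn_iteratedDeriv hX hF i
  rw [iteratedDeriv_succ, hasDerivAt_deriv_iff]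
  exact (h.contDiffAt (hX.mem_nhds hx)).differentiableAt (by simp)

theorem iteratedDeriv_eq_of_chain {X : Set ℝ} {F : ℝ → E} {U : ℕ → ℝ → E} (hX : IsOpen X)
    (h0 : ∀ x ∈ X, F x = U 0 x) (hU : ∀ i, ∀ x ∈ X, HasDerivAt (U i) (U (i + 1) x) x)
    (i : ℕ) {x : ℝ} (hx : x ∈ X) : iteratedDeriv i F x = U i x := by
  induction i generalizing x with
  | zero => simpa using h0 x hx
  | succ i ih =>
    rw [iteratedDeriv_succ]
    have : iteratedDeriv i F =ᶠ[nhds x] U i := by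
      filter_upwards [hX.mem_nhds hx] with y hy using ih hy
    rw [this.deriv_eq, (hU i x hx).deriv]

theorem contDiffOn_div_complex {G : Type*} [NormedAddCommGroup G] [NormedSpace ℝ G] {X : Set G}
    {f g : G → ℂ} (hf : ContDiffOn ℝ ∞ f X) (hg : ContDiffOn ℝ ∞ g X) (h : ∀ x ∈ X, g x ≠ 0) :
    ContDiffOn ℝ ∞ (fun x => f x / g x) X := by
  simp only [div_eq_mul_inv]
  exact hf.mul (hg.inv h)

/-- If two sequences of vector functions start from proportional vectors and the derivative of each
term is a multiple of the next one, then the first sequence (with nonvanishing multipliers `α`) is a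
triangular combination of the second, with smooth coefficients and explicit diagonal ones. -/
theorem exists_triangular {X : Set ℝ} {U V : ℕ → ℝ → E} {α β : ℕ → ℝ → ℂ} {q : ℝ → ℂ} {N : ℕ}
    [NormedSpace ℂ E] [IsScalarTower ℝ ℂ E] (hX : IsOpen X)
    (hα : ∀ i < N, ContDiffOn ℝ ∞ (α i) X) (hα0 : ∀ i < N, ∀ x ∈ X, α i x ≠ 0)
    (hβ : ∀ i < N, ContDiffOn ℝ ∞ (β i) X) (hq : ContDiffOn ℝ ∞ q X)
    (hU : ∀ i < N, ∀ x ∈ X, HasDerivAt (U i) (α i x • U (i + 1) x) x)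
    (hV : ∀ i < N, ∀ x ∈ X, HasDerivAt (V i) (β i x • V (i + 1) x) x)
    (h0 : ∀ x ∈ X, U 0 x = q x • V 0 x) (i : ℕ) (hi : i ≤ N) :
    ∃ a : ℕ → ℝ → ℂ, (∀ j, ContDiffOn ℝ ∞ (a j) X) ∧
      (∀ x ∈ X, U i x = ∑ j ∈ Finset.range (i + 1), a j x • V j x) ∧
      ∀ x ∈ X, a i x = q x * (∏ j ∈ Finset.range i, β j x) / ∏ j ∈ Finset.range i, α j x := by
  induction i with
  | zero => exact ⟨fun _ => q, fun _ => hq, fun x hx => by simpa using h0 x hx, by simp⟩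
  | succ i ih =>
    obtain ⟨a, ha, hsum, hdiag⟩ := ih (by omega)
    have had : ∀ j, ∀ x ∈ X, HasDerivAt (a j) (deriv (a j) x) x := fun j x hx =>
      (((ha j).contDiffAt (hX.mem_nhds hx)).differentiableAt (by simp)).hasDerivAt
    have key : ∀ x ∈ X, α i x • U (i + 1) x = ∑ j ∈ Finset.range (i + 1),
        (a j x • (β j x • V (j + 1) x) + deriv (a j) x • V j x) := by
      intro x hx
      refine (hU i (by omega) x hx).unique ?_
      have h := HasDerivAt.fun_sum (u := Finset.range (i + 1)) fun j hj =>
        (had j x hx).smul (hV j (by simp at hj; omega) x hx)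
      refine h.congr_of_eventuallyEq ?_
      filter_upwards [hX.mem_nhds hx] with y hy
      simpa using hsum y hy
    refine ⟨fun j x => ((if j ≤ i then deriv (a j) x else 0) +
      (if 1 ≤ j ∧ j ≤ i + 1 then a (j - 1) x * β (j - 1) x else 0)) / α i x, ?_, ?_, ?_⟩
    · intro j
      refine contDiffOn_div_complex (ContDiffOn.add ?_ ?_) (hα i (by omega)) (hα0 i (by omega))
      · by_cases h : j ≤ i
        · simpa [h] using ((contDiffOn_infty_iff_deriv_of_isOpen hX).1 (ha j)).2
        · simpa [h] using contDiffOn_const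
      · by_cases h : 1 ≤ j ∧ j ≤ i + 1
        · simpa [h] using (ha (j - 1)).mul (hβ (j - 1) (by omega))
        · simpa [h] using contDiffOn_const
    · intro x hx
      have h0 := hα0 i (by omega) x hx
      have := congrArg (fun v => (α i x)⁻¹ • v) (key x hx)
      simp only [smul_smul, inv_mul_cancel₀ h0, one_smul] at this
      rw [this]
      simp only [div_eq_inv_mul, ← smul_smul, ← Finset.smul_sum, add_smul, Finset.sum_add_distrib]
      congr 1
      rw [add_comm]
      congr 1
      · rw [Finset.sum_range_succ _ (i + 1)]
        simp only [show ¬ i + 1 ≤ i by omega, if_false, zero_smul, add_zero]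
        refine Finset.sum_congr rfl fun j hj => ?_
        rw [if_pos (by simp at hj; omega)]
      · rw [Finset.sum_range_succ' _ (i + 1)]
        simp only [show ¬ (1 ≤ 0 ∧ 0 ≤ i + 1) by omega, if_false, zero_smul, add_zero]
        refine Finset.sum_congr rfl fun j hj => ?_
        rw [if_pos (by simp at hj; omega)]
        simp [smul_smul]
    · intro x hx
      simp only [show ¬ i + 1 ≤ i by omega, if_false, zero_add]
      rw [if_pos (by omega), Nat.add_sub_cancel, hdiag x hx, Finset.prod_range_succ,
        Finset.prod_range_succ]
      field_simp

end Chains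

/-! ### The symplectic form and the pairings of a `C_n`-vector -/

section SymplecticForm

variable {n : ℕ}

theorem symp_eq_sum (v w : Idx n → ℂ) :
    symp v w = ∑ i, (v (Sum.inl i) * w (Sum.inr i) - v (Sum.inr i) * w (Sum.inl i)) := by
  simp [symp, Omega, dotProduct, Matrix.mulVec, Matrix.one_apply, Finset.sum_add_distrib,
    sub_eq_add_neg]

/-- The symplectic form as a bilinear map. -/
noncomputable def sympForm (n : ℕ) : (Idx n → ℂ) →ₗ[ℂ] (Idx n → ℂ) →ₗ[ℂ] ℂ :=
  Matrix.toLinearMap₂' ℂ (Omega n)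

theorem sympForm_apply (v w : Idx n → ℂ) : sympForm n v w = symp v w := by
  rw [sympForm, Matrix.toLinearMap₂'_apply', symp]

theorem symp_smul_left (c : ℂ) (v w : Idx n → ℂ) : symp (c • v) w = c * symp v w := by
  simp [← sympForm_apply]

theorem symp_smul_right (c : ℂ) (v w : Idx n → ℂ) : symp v (c • w) = c * symp v w := by
  simp [← sympForm_apply]

theorem symp_sum_smul {s t : Finset ℕ} (a b : ℕ → ℂ) (v w : ℕ → Idx n → ℂ) :
    symp (∑ i ∈ s, a i • v i) (∑ j ∈ t, b j • w j) =
      ∑ i ∈ s, ∑ j ∈ t, a i * (b j * symp (v i) (w j)) := by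
  simp [← sympForm_apply, map_sum, LinearMap.sum_apply, Finset.mul_sum]
  rw [Finset.sum_comm]
  exact Finset.sum_congr rfl fun i _ => Finset.sum_congr rfl fun j _ => by ring

theorem symp_comm (v w : Idx n → ℂ) : symp v w = -symp w v := by
  simp only [symp_eq_sum, ← Finset.sum_neg_distrib]
  exact Finset.sum_congr rfl fun i _ => by ring

theorem symp_self (v : Idx n → ℂ) : symp v v = 0 := by
  simp only [symp_eq_sum]
  exact Finset.sum_eq_zero fun i _ => by ring

theorem hasDerivAt_symp {v w : ℝ → Idx n → ℂ} {v' w' : Idx n → ℂ} {x : ℝ}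
    (hv : HasDerivAt v v' x) (hw : HasDerivAt w w' x) :
    HasDerivAt (fun y => symp (v y) (w y)) (symp v' (w x) + symp (v x) w') x := by
  rw [hasDerivAt_pi] at hv hw
  simp only [symp_eq_sum, ← Finset.sum_add_distrib]
  refine HasDerivAt.fun_sum fun i _ => ?_
  refine (((hv (Sum.inl i)).mul (hw (Sum.inr i))).sub
    ((hv (Sum.inr i)).mul (hw (Sum.inl i)))).congr_deriv ?_
  ring

theorem antidiagonal_alternating {s : ℕ} {d : ℕ → ℂ} (h : ∀ i < s, d (i + 1) = -d i)
    {i : ℕ} (hi : i ≤ s) : d i = (-1) ^ i * d 0 := by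
  induction i with
  | zero => simp
  | succ i ih => rw [h i (by omega), ih (by omega)]; ring

/-- Along a sequence of vector functions with `V_i' = V_{i+1}`, vanishing of all pairings of total
order `s` makes the pairings of total order `s + 1` alternate in sign. -/
theorem symp_alternating {X : Set ℝ} (hX : IsOpen X) {V : ℕ → ℝ → Idx n → ℂ}
    (hV : ∀ i, ∀ x ∈ X, HasDerivAt (V i) (V (i + 1) x) x) {s : ℕ}
    (h : ∀ i j, i + j = s → ∀ x ∈ X, symp (V i x) (V j x) = 0) {x : ℝ} (hx : x ∈ X) {i : ℕ}
    (hi : i ≤ s + 1) :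
    symp (V i x) (V (s + 1 - i) x) = (-1) ^ i * symp (V 0 x) (V (s + 1) x) := by
  refine antidiagonal_alternating (s := s + 1)
    (d := fun i => symp (V i x) (V (s + 1 - i) x)) (fun i hi => ?_) hi
  have h1 := hasDerivAt_symp (hV i x hx) (hV (s - i) x hx)
  have h2 : HasDerivAt (fun y => symp (V i y) (V (s - i) y)) 0 x := by
    refine (hasDerivAt_const x (0 : ℂ)).congr_of_eventuallyEq ?_
    filter_upwards [hX.mem_nhds hx] with y hy using h i (s - i) (by omega) y hy
  have h3 := h1.unique h2
  rw [show s - i + 1 = s + 1 - i by omega] at h3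
  simp only [show s + 1 - (i + 1) = s - i by omega]
  exact eq_neg_of_add_eq_zero_left h3

/-- The pairings `C(F^{(i)}, F^{(j)})` of a `C_n`-vector vanish for `i + j < 2n - 1`. -/
theorem IsCnVector.symp_eq_zero_of_add_lt {X : Set ℝ} (hX : IsOpen X) {F : ℝ → Idx n → ℂ}
    (hF : IsCnVector n X F) {i j : ℕ} (hij : i + j + 1 < 2 * n) {x : ℝ} (hx : x ∈ X) :
    symp (iteratedDeriv i F x) (iteratedDeriv j F x) = 0 := by
  have hV := fun i x (hx : x ∈ X) => hasDerivAt_iteratedDeriv hX hF.smooth i hx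
  obtain ⟨s, hs⟩ : ∃ s, i + j = s := ⟨_, rfl⟩
  induction s generalizing i j x with
  | zero =>
    obtain ⟨rfl, rfl⟩ : i = 0 ∧ j = 0 := by omega
    exact symp_self _
  | succ s ih =>
    have alt := fun (k : ℕ) (hk : k ≤ s + 1) => symp_alternating hX hV
      (s := s) (fun i j hij' x hx => ih (by omega) hx hij') hx hk
    -- the pairing in the middle of the antidiagonal vanishes
    have mid : ∃ k ≤ s + 1, symp (iteratedDeriv k F x) (iteratedDeriv (s + 1 - k) F x) = 0 := by
      obtain ⟨m, hm⟩ | ⟨m, hm⟩ := Nat.even_or_odd (s + 1)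
      · refine ⟨m, by omega, ?_⟩
        rw [show s + 1 - m = m by omega]
        exact symp_self _
      · refine ⟨m, by omega, ?_⟩
        rw [show s + 1 - m = m + 1 by omega]
        exact hF.symp_eq_zero m (by omega) x hx
    obtain ⟨k, hk, hk0⟩ := mid
    rw [alt k hk] at hk0
    have h0 : symp (iteratedDeriv 0 F x) (iteratedDeriv (s + 1) F x) = 0 := by simpa using hk0
    have := alt i (by omega)
    rwa [h0, mul_zero, show s + 1 - i = j by omega] at this

/-- The pairings `C(F^{(i)}, F^{(j)})` of a `C_n`-vector with `i + j = 2n - 1` are alternating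
signs. -/
theorem IsCnVector.symp_of_add_eq {X : Set ℝ} (hX : IsOpen X) {F : ℝ → Idx n → ℂ}
    (hF : IsCnVector n X F) {i j : ℕ} (hij : i + j + 1 = 2 * n) {x : ℝ} (hx : x ∈ X) :
    symp (iteratedDeriv i F x) (iteratedDeriv j F x) = (-1) ^ (n + i) := by
  have hV := fun i x (hx : x ∈ X) => hasDerivAt_iteratedDeriv hX hF.smooth i hx
  have hn : 1 ≤ n := by omega
  have alt := fun (k : ℕ) (hk : k ≤ 2 * n - 2 + 1) => symp_alternating hX hV
      (s := 2 * n - 2) (fun i j hij' x hx => hF.symp_eq_zero_of_add_lt hX (by omega) hx) hx hk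
  have h1 := alt (n - 1) (by omega)
  rw [show 2 * n - 2 + 1 - (n - 1) = n by omega, hF.symp_eq_neg_one x hx] at h1
  have h2 := alt i (by omega)
  rw [show 2 * n - 2 + 1 - i = j by omega] at h2
  rw [h2]
  obtain ⟨m, rfl⟩ : ∃ m, n = m + 1 := ⟨n - 1, by omega⟩
  rw [Nat.add_sub_cancel] at h1
  have hs : ((-1 : ℂ) ^ m) * (-1) ^ m = 1 := by rw [← mul_pow]; simp
  have h3 := congrArg (fun z => (-1 : ℂ) ^ m * z) h1
  simp only [← mul_assoc, hs, one_mul] at h3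
  rw [← h3]; ring

end SymplecticForm

/-! ### Determinants: Desnanot–Jacobi, symplectic duality, derivatives -/

section Determinants

/-- The increasing index sequence `0, 1, …, m - 1, a` labelling the rows or columns of a bordered
minor. -/
def borderIdx (m a : ℕ) (j : Fin (m + 1)) : ℕ := if (j : ℕ) < m then j else a

theorem borderIdx_self (m : ℕ) (j : Fin (m + 1)) : borderIdx m m j = j := by
  unfold borderIdx; split_ifs <;> omega

/-- Bordered minors of a matrix in terms of a Schur complement `s`. It yields the
Desnanot–Jacobi identity, whose nonlinear terms are the entries of `s`. -/
theorem exists_schur {m : ℕ} (f : ℕ → ℕ → ℂ)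
    (hA : Matrix.det (Matrix.of fun j k : Fin m => f j k) ≠ 0) :
    ∃ s : ℕ → ℕ → ℂ,
      (∀ a b, Matrix.det (Matrix.of fun j k : Fin (m + 1) =>
          f (borderIdx m a j) (borderIdx m b k)) =
        Matrix.det (Matrix.of fun j k : Fin m => f j k) * s a b) ∧
      Matrix.det (Matrix.of fun j k : Fin (m + 2) => f j k) =
        Matrix.det (Matrix.of fun j k : Fin m => f j k) *
          (s m m * s (m + 1) (m + 1) - s m (m + 1) * s (m + 1) m) := by
  set A : Matrix (Fin m) (Fin m) ℂ := Matrix.of fun j k : Fin m => f j k with hAdef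
  let := A.invertibleOfIsUnitDet (isUnit_iff_ne_zero.2 hA)
  refine ⟨fun a b => f a b - ∑ k : Fin m, (∑ j : Fin m, f a j * (⅟A) j k) * f k b, ?_, ?_⟩
  · intro a b
    rw [← Matrix.det_submatrix_equiv_self finSumFinEquiv]
    have : (Matrix.of fun j k : Fin (m + 1) =>
        f (borderIdx m a j) (borderIdx m b k)).submatrix finSumFinEquiv finSumFinEquiv =
        Matrix.fromBlocks A (Matrix.of fun (j : Fin m) (_ : Fin 1) => f j b)
          (Matrix.of fun (_ : Fin 1) (k : Fin m) => f a k)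
          (Matrix.of fun (_ _ : Fin 1) => f a b) := by
      ext j k
      rcases j with j | j <;> rcases k with k | k <;> simp [borderIdx, hAdef]
    rw [this, Matrix.det_fromBlocks₁₁]
    simp [Matrix.mul_apply]
  · rw [← Matrix.det_submatrix_equiv_self finSumFinEquiv]
    have : (Matrix.of fun j k : Fin (m + 2) =>
        f j k).submatrix finSumFinEquiv finSumFinEquiv =
        Matrix.fromBlocks A (Matrix.of fun (j : Fin m) (b : Fin 2) => f j (m + b))
          (Matrix.of fun (a : Fin 2) (k : Fin m) => f (m + a) k)
          (Matrix.of fun (a b : Fin 2) => f (m + a) (m + b)) := by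
      ext j k
      rcases j with j | j <;> rcases k with k | k <;> simp [hAdef]
    rw [this, Matrix.det_fromBlocks₁₁, Matrix.det_fin_two]
    simp [Matrix.mul_apply]

/-- A matrix whose rows from number `m` on are upper unitriangular has the determinant of its leading
`m × m` block. -/
theorem det_eq_leading {M : ℕ → ℕ → ℂ} {m N : ℕ} (hm : m ≤ N)
    (h0 : ∀ i j, m ≤ i → i < N → j < i → M i j = 0) (h1 : ∀ i, m ≤ i → i < N → M i i = 1) :
    Matrix.det (Matrix.of fun i j : Fin N => M i j) =
      Matrix.det (Matrix.of fun i j : Fin m => M i j) := by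
  induction N, hm using Nat.le_induction with
  | base => rfl
  | succ N hN ih =>
    rw [← ih (fun i j hi hi' hj => h0 i j hi (by omega) hj) (fun i hi hi' => h1 i hi (by omega)),
      Matrix.det_succ_row _ (Fin.last N), Fin.sum_univ_castSucc, Finset.sum_eq_zero]
    · simp [h1 N hN (by omega), ← two_mul, Matrix.submatrix]
    · intro j _
      simp [h0 N j hN (by omega) j.2]

/-- A matrix whose first `m` columns are upper unitriangular has the determinant of the remaining
block, read here from its last row and column backwards. -/
theorem det_eq_trailing {M : ℕ → ℕ → ℂ} {m N : ℕ} (hm : m ≤ N)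
    (h0 : ∀ i j, j < m → i < N → j < i → M i j = 0) (h1 : ∀ i, i < m → M i i = 1) :
    Matrix.det (Matrix.of fun i j : Fin N => M i j) =
      Matrix.det (Matrix.of fun i j : Fin (N - m) => M (N - 1 - i) (N - 1 - j)) := by
  have h := det_eq_leading (M := fun i j => M (N - 1 - j) (N - 1 - i)) (m := N - m) (N := N)
    (by omega) (fun i j hi hi' hj => h0 _ _ (by omega) (by omega) (by omega))
    (fun i hi hi' => h1 _ (by omega))
  rw [← Matrix.det_transpose, ← Matrix.det_submatrix_equiv_self Fin.revPerm,
    ← Matrix.det_transpose (Matrix.of fun i j : Fin (N - m) => _)]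
  refine Eq.trans ?_ h
  congr 1
  ext i j
  simp only [Matrix.submatrix_apply, Matrix.transpose_apply, Matrix.of_apply, Fin.revPerm_apply,
    Fin.val_rev]
  congr 1 <;> omega

/-- Multiplicativity of the determinant for `2n` vectors indexed by numbers; `d` depends on an
identification of `Idx n` with `Fin (2 * n)`, which is why only its existence is stated. -/
theorem exists_det_dotProduct (n : ℕ) : ∃ d : (ℕ → Idx n → ℂ) → ℂ, ∀ v w : ℕ → Idx n → ℂ,
    Matrix.det (Matrix.of fun i j : Fin (2 * n) => v i ⬝ᵥ w j) = d v * d w := by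
  let e : Fin (2 * n) ≃ Idx n := (finCongr (two_mul n)).trans finSumFinEquiv.symm
  refine ⟨fun v => Matrix.det (Matrix.of fun i k : Fin (2 * n) => v i (e k)), fun v w => ?_⟩
  beta_reduce
  rw [← Matrix.det_transpose (Matrix.of fun i k : Fin (2 * n) => w i (e k)), ← Matrix.det_mul]
  congr 1
  ext i j
  simp only [Matrix.of_apply, Matrix.mul_apply, Matrix.transpose_apply, dotProduct]
  exact (e.sum_comp fun k => v i k * w j k).symm

/-- Symplectic duality of the determinants `T m = det (f_j · g_k)_{j, k < m}`: if the Gram matrices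
of `f` and `g` under the symplectic form have the shape found for `C_n`-vectors, then
`T (n + 1) = T (n - 1)`. -/
theorem det_dotProduct_succ_eq_pred {n : ℕ} (hn : 1 ≤ n) {f g : ℕ → Idx n → ℂ}
    (hf0 : ∀ i j, i + j + 1 < 2 * n → symp (f i) (f j) = 0)
    (hf1 : ∀ i j, i + j + 1 = 2 * n → symp (f i) (f j) = (-1) ^ (n + i))
    (hg0 : ∀ i j, i + j + 1 < 2 * n → symp (g i) (g j) = 0)
    (hg1 : ∀ i j, i + j + 1 = 2 * n → symp (g i) (g j) = (-1) ^ (n + i))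
    (hT : Matrix.det (Matrix.of fun j k : Fin n => f j ⬝ᵥ g k) ≠ 0) :
    Matrix.det (Matrix.of fun j k : Fin (n + 1) => f j ⬝ᵥ g k) =
      Matrix.det (Matrix.of fun j k : Fin (n - 1) => f j ⬝ᵥ g k) := by
  obtain ⟨d, hd⟩ := exists_det_dotProduct n
  -- `dual v i` is the vector `w` with `w · u = ± C(u, v (2n - 1 - i))`
  let dual (v : ℕ → Idx n → ℂ) (i : ℕ) : Idx n → ℂ :=
    (-(-1) ^ (n + i) : ℂ) • (v (2 * n - 1 - i) ᵥ* Omega n)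
  have hsq : ∀ k : ℕ, ((-1 : ℂ) ^ k) * (-1) ^ k = 1 := fun k => by rw [← mul_pow]; simp
  have hdot : ∀ (v : ℕ → Idx n → ℂ) i (u : Idx n → ℂ),
      dual v i ⬝ᵥ u = -(-1) ^ (n + i) * symp (v (2 * n - 1 - i)) u := fun v i u => by
    simp only [dual, smul_dotProduct, symp, smul_eq_mul, Matrix.dotProduct_mulVec]
  have hdual0 : ∀ {v : ℕ → Idx n → ℂ}, (∀ i j, i + j + 1 < 2 * n → symp (v i) (v j) = 0) →
      ∀ i j, i < 2 * n → j < i → dual v i ⬝ᵥ v j = 0 := fun hv i j hi hj => by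
    rw [hdot, hv _ _ (by omega), mul_zero]
  have hdual1 : ∀ {v : ℕ → Idx n → ℂ},
      (∀ i j, i + j + 1 = 2 * n → symp (v i) (v j) = (-1) ^ (n + i)) →
      ∀ i, i < 2 * n → dual v i ⬝ᵥ v i = 1 := fun hv i hi => by
    rw [hdot, symp_comm, hv _ _ (by omega), neg_mul_neg, hsq]
  have hdd : ∀ (v w : ℕ → Idx n → ℂ) i j, dual v i ⬝ᵥ dual w j =
      ((-1) ^ (n + i) * (-1) ^ (n + j)) * (v (2 * n - 1 - i) ⬝ᵥ w (2 * n - 1 - j)) := by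
    intro v w i j
    have hO : ∀ a b : Idx n → ℂ, (a ᵥ* Omega n) ⬝ᵥ (b ᵥ* Omega n) = a ⬝ᵥ b := fun a b => by
      rw [← Matrix.mulVec_transpose _ b, Matrix.dotProduct_mulVec, Matrix.vecMul_vecMul]
      simp [Omega, Matrix.fromBlocks_transpose, Matrix.fromBlocks_multiply]
    simp only [dual, smul_dotProduct, dotProduct_smul, hO, smul_eq_mul]
    ring
  -- `R m` interpolates between `f` (the first `m` vectors) and the dual of `g`
  let R (m i : ℕ) : Idx n → ℂ := if i < m then f i else dual g i
  have h1 : ∀ m ≤ 2 * n, d (R m) * d g =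
      Matrix.det (Matrix.of fun j k : Fin m => f j ⬝ᵥ g k) := by
    intro m hm
    rw [← hd, det_eq_leading (M := fun i j => R m i ⬝ᵥ g j) hm]
    · congr 1
      ext i j
      simp [R]
    · intro i j hi hi' hj
      simpa [R, not_lt.2 hi] using hdual0 hg0 i j hi' hj
    · intro i hi hi'
      simpa [R, not_lt.2 hi] using hdual1 hg1 i hi'
  have h2 : ∀ m ≤ 2 * n, d (dual f) * d (R m) =
      Matrix.det (Matrix.of fun j k : Fin (2 * n - m) => f j ⬝ᵥ g k) := by
    intro m hm
    rw [← hd, det_eq_trailing (M := fun i j => dual f i ⬝ᵥ R m j) hm]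
    · have hmat : (Matrix.of fun i j : Fin (2 * n - m) =>
          dual f (2 * n - 1 - i) ⬝ᵥ R m (2 * n - 1 - j)) =
          Matrix.diagonal (fun i : Fin (2 * n - m) => (-1 : ℂ) ^ (n + (2 * n - 1 - i))) *
            (Matrix.of fun j k : Fin (2 * n - m) => f j ⬝ᵥ g k) *
          Matrix.diagonal (fun i : Fin (2 * n - m) => (-1 : ℂ) ^ (n + (2 * n - 1 - i))) := by
        ext i j
        have hi := i.2
        have hj := j.2
        rw [Matrix.mul_diagonal, Matrix.diagonal_mul]
        simp only [Matrix.of_apply, R, if_neg (show ¬ 2 * n - 1 - (j : ℕ) < m by omega), hdd]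
        rw [show 2 * n - 1 - (2 * n - 1 - (i : ℕ)) = i by omega,
          show 2 * n - 1 - (2 * n - 1 - (j : ℕ)) = j by omega]
        ring
      rw [hmat, Matrix.det_mul, Matrix.det_mul, mul_right_comm, ← Matrix.det_mul,
        Matrix.diagonal_mul_diagonal]
      simp only [hsq, Matrix.diagonal_one, Matrix.det_one, one_mul]
    · intro i j hj hi hij
      simpa [R, hj] using hdual0 hf0 i j hi hij
    · intro i hi
      simpa [R, hi] using hdual1 hf1 i (by omega)
  -- the nonzero middle determinant forces the constants to agree
  have h3 := h1 n (by omega)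
  have h4 := h2 n (by omega)
  rw [show 2 * n - n = n by omega, ← h3, mul_comm] at h4
  have hR : d (R n) ≠ 0 := fun h => hT (by rw [← h3, h, zero_mul])
  have h5 : d (dual f) = d g := mul_left_cancel₀ hR h4
  have h6 := h2 (n + 1) (by omega)
  rw [show 2 * n - (n + 1) = n - 1 by omega] at h6
  rw [← h1 (n + 1) (by omega), ← h6, h5, mul_comm]

theorem hasDerivAt_det {l : ℕ} {M : ℝ → Matrix (Fin l) (Fin l) ℂ} {M' : Matrix (Fin l) (Fin l) ℂ}
    {x : ℝ} (h : ∀ i j, HasDerivAt (fun y => M y i j) (M' i j) x) :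
    HasDerivAt (fun y => (M y).det) (∑ i, ((M x).updateRow i (M' i)).det) x := by
  let D : ContinuousMultilinearMap ℝ (fun _ : Fin l => Fin l → ℂ) ℂ :=
    { (Matrix.detRowAlternating (R := ℂ) (n := Fin l)).toMultilinearMap.restrictScalars ℝ with
      cont := Continuous.matrix_det continuous_id }
  have hrow : ∀ i, HasDerivAt (fun y => M y i) (M' i) x := fun i => hasDerivAt_pi.2 (h i)
  have := (HasFDerivAt.multilinear_comp (f := D) fun i => (hrow i).hasFDerivAt).hasDerivAt
  refine this.congr_deriv ?_
  simp only [sum_apply, ContinuousLinearMap.comp_apply]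
  refine Finset.sum_congr rfl fun i _ => ?_
  simp
  rfl

/-- Differentiating a Wronskian-type determinant only changes its last row. -/
theorem hasDerivAt_det_border {m : ℕ} {f : ℕ → ℕ → ℝ → ℂ} {x : ℝ}
    (h : ∀ j k, HasDerivAt (f j k) (f (j + 1) k x) x) (c : Fin (m + 1) → ℕ) :
    HasDerivAt (fun y => Matrix.det (Matrix.of fun j k : Fin (m + 1) =>
        f (borderIdx m m j) (c k) y))
      (Matrix.det (Matrix.of fun j k : Fin (m + 1) => f (borderIdx m (m + 1) j) (c k) x)) x := by
  refine (hasDerivAt_det (M := fun y => Matrix.of fun j k : Fin (m + 1) =>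
    f (borderIdx m m j) (c k) y) (M' := Matrix.of fun j k : Fin (m + 1) =>
    f (j + 1) (c k) x) fun j k => ?_).congr_deriv ?_
  · simp only [borderIdx_self, Matrix.of_apply]
    exact h j (c k)
  · rw [Fin.sum_univ_castSucc, Finset.sum_eq_zero, zero_add]
    · congr 1
      ext j k
      refine Fin.lastCases ?_ (fun j => ?_) j
      · simp [borderIdx]
      · rw [Matrix.updateRow_ne (Fin.castSucc_lt_last j).ne]
        simp [borderIdx]
    · intro j _
      refine Matrix.det_zero_of_row_eq (i := j.castSucc) (j := j.succ)
        (Fin.castSucc_lt_succ).ne ?_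
      ext k
      rw [Matrix.updateRow_self, Matrix.updateRow_ne (Fin.castSucc_lt_succ).ne']
      simp [borderIdx_self]

end Determinants

/-! ### Smoothness of continuous branches -/

section Branches

/-- A continuous solution `w` of `f (w x) = t x`, where `f` is holomorphic with nonvanishing
derivative along `w`, is as smooth as `t`: near each point it is the local inverse of `f`
composed with `t`. -/
theorem contDiffOn_of_comp_eq {E : Type*} [NormedAddCommGroup E] [NormedSpace ℝ E] {W : Set E}
    (hW : IsOpen W) {f : ℂ → ℂ} {f' : ℂ → ℂ} (hf : ContDiff ℂ ∞ f)
    (hf' : ∀ z, HasDerivAt f (f' z) z) {w t : E → ℂ} (hw : ContinuousOn w W)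
    (hne : ∀ x ∈ W, f' (w x) ≠ 0) (h : ∀ x ∈ W, f (w x) = t x) (ht : ContDiffOn ℝ ∞ t W) :
    ContDiffOn ℝ ∞ w W := by
  intro x hx
  have hs : HasStrictDerivAt f (f' (w x)) (w x) :=
    hf.contDiffAt.hasStrictDerivAt' (hf' _) (by simp)
  have hinv := hf.contDiffAt.to_localInverse (hs.hasStrictFDerivAt_equiv (hne x hx)).hasFDerivAt
    (by simp)
  have hwx : ContinuousAt w x := hw.continuousAt (hW.mem_nhds hx)
  have hev := hwx.eventually (hs.hasStrictFDerivAt_equiv (hne x hx)).eventually_left_inverse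
  refine ContDiffAt.contDiffWithinAt ?_
  have hcomp := ContDiffAt.comp x (g := _) ((h x hx ▸ hinv).restrict_scalars ℝ)
    (ht.contDiffAt (hW.mem_nhds hx))
  refine hcomp.congr_of_eventuallyEq ?_
  filter_upwards [hev, hW.mem_nhds hx] with y hy hyW
  rw [Function.comp_apply, ← h y hyW]
  exact hy.symm

end Branches

/-! ### The Toda field equations -/

section Toda

variable {n : ℕ}

theorem contDiffOn_tau {X Y : Set ℝ} (hX : IsOpen X) (hY : IsOpen Y) {F G : ℝ → Idx n → ℂ}
    (hF : ContDiffOn ℝ ∞ F X) (hG : ContDiffOn ℝ ∞ G Y) (i : ℕ) :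
    ContDiffOn ℝ ∞ (Function.uncurry (tau F G i)) (X ×ˢ Y) := by
  have hf : ∀ j (l : Idx n), ContDiffOn ℝ ∞ (fun p : ℝ × ℝ => iteratedDeriv j F p.1 l) (X ×ˢ Y) :=
    fun j l => (contDiffOn_pi.1 (contDiffOn_iteratedDeriv hX hF j) l).comp contDiffOn_fst
      fun p hp => hp.1
  have hg : ∀ j (l : Idx n), ContDiffOn ℝ ∞ (fun p : ℝ × ℝ => iteratedDeriv j G p.2 l) (X ×ˢ Y) :=
    fun j l => (contDiffOn_pi.1 (contDiffOn_iteratedDeriv hY hG j) l).comp contDiffOn_snd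
      fun p hp => hp.2
  have : Function.uncurry (tau F G i) = fun p : ℝ × ℝ => ∑ σ : Equiv.Perm (Fin i),
      ((Equiv.Perm.sign σ : ℤ) : ℂ) * ∏ k : Fin i,
        ∑ l, iteratedDeriv (σ k : ℕ) F p.1 l * iteratedDeriv (k : ℕ) G p.2 l := by
    ext p
    simp only [Function.uncurry, tau, Matrix.det_apply', Matrix.of_apply, dotProduct]
  rw [this]
  exact ContDiffOn.sum fun σ _ => contDiffOn_const.mul <| contDiffOn_prod fun k _ =>
    ContDiffOn.sum fun l _ => (hf _ l).mul (hg _ l)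

theorem hasDerivAt_dotProduct_const {v : ℝ → Idx n → ℂ} {v' : Idx n → ℂ} {x : ℝ}
    (hv : HasDerivAt v v' x) (w : Idx n → ℂ) :
    HasDerivAt (fun y => v y ⬝ᵥ w) (v' ⬝ᵥ w) x := by
  rw [hasDerivAt_pi] at hv
  exact HasDerivAt.fun_sum fun l _ => (hv l).mul_const (w l)

/-- The mixed second derivative of a continuous branch of `-log τ_{m+1}`, from the
Desnanot–Jacobi identity `τ_{m+1} ∂_x∂_y τ_{m+1} - ∂_x τ_{m+1} ∂_y τ_{m+1} = τ_m τ_{m+2}`. -/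
theorem deriv_deriv_negLog_tau {X Y : Set ℝ} (hX : IsOpen X) (hY : IsOpen Y)
    {F G : ℝ → Idx n → ℂ} (hF : ContDiffOn ℝ ∞ F X) (hG : ContDiffOn ℝ ∞ G Y)
    {W : Set (ℝ × ℝ)} (hW : IsOpen W) (hWXY : W ⊆ X ×ˢ Y) {u : ℝ → ℝ → ℂ} {m : ℕ}
    (hu : ContDiffOn ℝ ∞ (Function.uncurry u) W)
    (hexp : ∀ x y, (x, y) ∈ W → Complex.exp (-u x y) = tau F G (m + 1) x y)
    {x y : ℝ} (hxy : (x, y) ∈ W) (hm : tau F G m x y ≠ 0) :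
    deriv (fun y' => deriv (fun x' => u x' y') x) y =
      -(tau F G m x y * tau F G (m + 2) x y / tau F G (m + 1) x y ^ 2) := by
  let f (j k : ℕ) (x y : ℝ) : ℂ := iteratedDeriv j F x ⬝ᵥ iteratedDeriv k G y
  let P (a b : ℕ) (x y : ℝ) : ℂ := Matrix.det (Matrix.of fun j k : Fin (m + 1) =>
    f (borderIdx m a j) (borderIdx m b k) x y)
  have hP : ∀ x y, tau F G (m + 1) x y = P m m x y := fun x y => by
    simp only [P, f, borderIdx_self]; rfl
  have hPx : ∀ b, ∀ x ∈ X, ∀ y, HasDerivAt (fun x' => P m b x' y) (P (m + 1) b x y) x :=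
    fun b x hx y => hasDerivAt_det_border (f := fun j k x' => f j k x' y)
      (fun j k => hasDerivAt_dotProduct_const (hasDerivAt_iteratedDeriv hX hF j hx) _) _
  have hPy : ∀ a x, ∀ y ∈ Y, HasDerivAt (fun y' => P a m x y') (P a (m + 1) x y) y := by
    intro a x y hy
    have := hasDerivAt_det_border (f := fun j k y' => f k j x y') (x := y)
      (fun j k => by
        simp only [f, dotProduct_comm (iteratedDeriv k F x)]
        exact hasDerivAt_dotProduct_const (hasDerivAt_iteratedDeriv hY hG j hy) _)
      (borderIdx m a)
    simp only [P]
    rw [← Matrix.det_transpose]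
    refine this.congr_of_eventuallyEq (Filter.Eventually.of_forall fun y' => ?_)
    beta_reduce
    rw [← Matrix.det_transpose]
    rfl
  have hne : ∀ x y, (x, y) ∈ W → P m m x y ≠ 0 := fun x y h => by
    rw [← hP, ← hexp x y h]; exact Complex.exp_ne_zero _
  have hux : ∀ x y, (x, y) ∈ W → deriv (fun x' => u x' y) x = -(P (m + 1) m x y / P m m x y) := by
    intro x y h
    have hd : DifferentiableAt ℝ (fun x' => u x' y) x :=
      ((hu.contDiffAt (hW.mem_nhds h)).differentiableAt (by simp)).comp
        (f := fun x' : ℝ => (x', y)) x (by fun_prop)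
    have h1 := hd.hasDerivAt.neg.cexp
    have h2 : HasDerivAt (fun x' => Complex.exp (-u x' y)) (P (m + 1) m x y) x := by
      refine (hPx m x (hWXY h).1 y).congr_of_eventuallyEq ?_
      filter_upwards [(hW.preimage (Continuous.prodMk_left y)).mem_nhds h] with x' hx'
      rw [← hP]
      exact hexp x' y hx'
    have h3 := h1.unique h2
    simp only [Pi.neg_apply] at h3
    rw [hexp x y h, hP] at h3
    rw [← h3]
    field_simp [hne x y h]
  have hderiv : HasDerivAt (fun y' => -(P (m + 1) m x y' / P m m x y'))
      (-((P (m + 1) (m + 1) x y * P m m x y - P (m + 1) m x y * P m (m + 1) x y) /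
        P m m x y ^ 2)) y :=
    ((hPy (m + 1) x y (hWXY hxy).2).div (hPy m x y (hWXY hxy).2) (hne x y hxy)).neg
  have hev : (fun y' => deriv (fun x' => u x' y') x) =ᶠ[nhds y]
      fun y' => -(P (m + 1) m x y' / P m m x y') := by
    filter_upwards [(hW.preimage (Continuous.prodMk_right x)).mem_nhds hxy] with y' hy'
    exact hux x y' hy'
  rw [hev.deriv_eq, hderiv.deriv, hP]
  obtain ⟨s, hs1, hs2⟩ := exists_schur (m := m) (fun j k => f j k x y) hm
  have e1 : ∀ a b, P a b x y = tau F G m x y * s a b := fun a b => hs1 a b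
  have e2 : tau F G (m + 2) x y = _ := hs2
  change _ = tau F G m x y * _ at e2
  rw [e2]
  simp only [e1]
  congr 2
  ring

/-- The exponentials of the rows of the Cartan matrix of type `C_n`. In the last row, the entry `-2`
is accounted for by `t (n + 1) = t (n - 1)`, so that all rows have the same form. -/
theorem exp_cartanC_sum {i : ℕ} (hi : i < n) {v : Fin n → ℂ} {t : ℕ → ℂ}
    (hv : ∀ j : Fin n, Complex.exp (-v j) = t (j + 1)) (h0 : t 0 = 1)
    (hlast : t (n + 1) = t (n - 1)) :
    Complex.exp (∑ j, (CartanMatrix.C n ⟨i, hi⟩ j : ℂ) * v j) =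
      t i * t (i + 2) / t (i + 1) ^ 2 := by
  have hsum : ∀ (k : ℕ) (c : ℂ), ∑ j : Fin n, (if (j : ℕ) = k then c else 0) * v j =
      if h : k < n then c * v ⟨k, h⟩ else 0 := by
    intro k c
    split_ifs with h
    · rw [Finset.sum_eq_single ⟨k, h⟩]
      · simp
      · intro j _ hj
        rw [if_neg (fun e => hj (Fin.ext e)), zero_mul]
      · simp
    · refine Finset.sum_eq_zero fun j _ => ?_
      rw [if_neg (by omega), zero_mul]
  have hC : ∀ j : Fin n, (CartanMatrix.C n ⟨i, hi⟩ j : ℂ) =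
      (if (j : ℕ) = i then 2 else 0) + (if (j : ℕ) = i + 1 then -1 else 0) +
        (if 1 ≤ i then (if (j : ℕ) = i - 1 then (if i + 1 = n then -2 else -1) else 0) else 0) := by
    intro j
    have hj := j.2
    simp only [CartanMatrix.C, Matrix.of_apply, Fin.ext_iff]
    split_ifs <;> first | omega | simp
  have hi1 := hv ⟨i, hi⟩
  simp only at hi1
  rw [Complex.exp_neg] at hi1
  have e2 : Complex.exp (2 * v ⟨i, hi⟩) = 1 / t (i + 1) ^ 2 := by
    rw [← hi1, two_mul, Complex.exp_add]
    field_simp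
  have hnext : (if h : i + 1 < n then Complex.exp (-1 * v ⟨i + 1, h⟩) else t (i + 2)) =
      t (i + 2) := by
    split_ifs with h
    · rw [neg_one_mul, hv]
    · rfl
  simp only [hC, add_mul, Finset.sum_add_distrib, hsum, dif_pos hi]
  rcases Nat.eq_zero_or_pos i with rfl | hpos
  · simp only [show ¬ 1 ≤ 0 by omega, if_false, zero_mul, Finset.sum_const_zero, add_zero]
    rw [Complex.exp_add, e2, h0]
    by_cases h : 0 + 1 < n
    · rw [dif_pos h, neg_one_mul, hv]
      simp only; ring
    · obtain rfl : n = 1 := by omega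
      simp only [dif_neg h, Complex.exp_zero]
      rw [show 0 + 2 = 1 + 1 by rfl, hlast]
      simp [h0]
  · obtain ⟨k, rfl⟩ : ∃ k, i = k + 1 := ⟨i - 1, by omega⟩
    simp only [show 1 ≤ k + 1 by omega, if_true, hsum, Nat.add_sub_cancel,
      dif_pos (show k < n by omega)]
    have hk := hv ⟨k, by omega⟩
    simp only at hk
    rw [Complex.exp_add, Complex.exp_add, e2]
    by_cases h : k + 1 + 1 < n
    · rw [dif_pos h, if_neg (by omega), neg_one_mul, neg_one_mul, hv, hk]
      simp only; ring
    · obtain rfl : n = k + 2 := by omega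
      rw [dif_neg h, if_pos rfl, show (-2 : ℂ) * v ⟨k, by omega⟩ =
        -v ⟨k, by omega⟩ + -v ⟨k, by omega⟩ by ring, Complex.exp_add, hk, Complex.exp_zero, hlast]
      simp only [show k + 2 - 1 = k + 1 by omega]
      ring

theorem isTodaSolution_of_isCnVector (hn : 1 ≤ n) {X Y : Set ℝ} {F G : ℝ → Idx n → ℂ}
    (hX : IsOpen X) (hY : IsOpen Y) (hF : IsCnVector n X F) (hG : IsCnVector n Y G)
    {W : Set (ℝ × ℝ)} {u : Fin n → ℝ → ℝ → ℂ} (hW : IsOpen W) (hWXY : W ⊆ X ×ˢ Y)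
    (hu : ∀ i : Fin n, IsNegLog W (u i) (tau F G ((i : ℕ) + 1))) :
    IsTodaSolution (CartanMatrix.C n) W u := by
  have hsm : ∀ i, ContDiffOn ℝ ∞ (Function.uncurry (u i)) W := fun i =>
    contDiffOn_of_comp_eq hW (f := fun z => Complex.exp (-z)) (f' := fun z => -Complex.exp (-z))
      (Complex.contDiff_exp.comp contDiff_neg)
      (fun z => by simpa using ((hasDerivAt_id z).neg).cexp)
      (hu i).1 (fun x _ => neg_ne_zero.2 (Complex.exp_ne_zero _))
      (fun p hp => (hu i).2 p.1 p.2 hp)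
      ((contDiffOn_tau hX hY hF.smooth hG.smooth _).mono hWXY)
  refine ⟨hsm, fun i x y hxy => ?_⟩
  have h0 : tau F G 0 x y = 1 := by simp [tau]
  have hne : ∀ m ≤ n, tau F G m x y ≠ 0 := by
    intro m hm
    rcases Nat.eq_zero_or_pos m with rfl | hpos
    · simp [h0]
    · have := (hu ⟨m - 1, by omega⟩).2 x y hxy
      simp only [Nat.sub_add_cancel hpos] at this
      rw [← this]
      exact Complex.exp_ne_zero _
  have hx := (hWXY hxy).1
  have hy := (hWXY hxy).2
  have hdual : tau F G (n + 1) x y = tau F G (n - 1) x y :=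
    det_dotProduct_succ_eq_pred hn (f := fun j => iteratedDeriv j F x)
      (g := fun k => iteratedDeriv k G y)
      (fun i j h => hF.symp_eq_zero_of_add_lt hX h hx) (fun i j h => hF.symp_of_add_eq hX h hx)
      (fun i j h => hG.symp_eq_zero_of_add_lt hY h hy) (fun i j h => hG.symp_of_add_eq hY h hy)
      (hne n le_rfl)
  rw [deriv_deriv_negLog_tau hX hY hF.smooth hG.smooth hW hWXY (hsm i) (hu i).2 hxy
    (hne i i.2.le)]
  exact congrArg Neg.neg (exp_cartanC_sum i.2 (v := fun j => u j x y)
    (t := fun j => tau F G j x y) (fun j => (hu j).2 x y hxy) h0 hdual).symm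

end Toda

/-! ### Iterated integrals -/

section IteratedIntegrals

theorem hasDerivAt_integral_of_continuousOn {X : Set ℝ} (hX : IsOpen X) (hXc : X.OrdConnected)
    (h0 : (0 : ℝ) ∈ X) {f : ℝ → ℂ} (hf : ContinuousOn f X) {x : ℝ} (hx : x ∈ X) :
    HasDerivAt (fun y => ∫ t in (0 : ℝ)..y, f t) (f x) x :=
  intervalIntegral.integral_hasDerivAt_right
    ((hf.mono (hXc.uIcc_subset h0 hx)).intervalIntegrable)
    (hf.stronglyMeasurableAtFilter hX x hx) (hf.continuousAt (hX.mem_nhds hx))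

theorem contDiffOn_iterInt {X : Set ℝ} (hX : IsOpen X) (hXc : X.OrdConnected)
    (h0 : (0 : ℝ) ∈ X) {φ : ℕ → ℝ → ℂ} {l : List ℕ} (hφ : ∀ a ∈ l, ContDiffOn ℝ ∞ (φ a) X) :
    ContDiffOn ℝ ∞ (iterInt φ l) X := by
  induction l with
  | nil => exact contDiffOn_const
  | cons a l ih =>
    have h := (hφ a (by simp)).mul (ih fun b hb => hφ b (by simp [hb]))
    have hd : ∀ x ∈ X, HasDerivAt (iterInt φ (a :: l)) (φ a x * iterInt φ l x) x :=
      fun x hx => hasDerivAt_integral_of_continuousOn hX hXc h0 h.continuousOn hx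
    exact (contDiffOn_infty_iff_deriv_of_isOpen hX).2
      ⟨fun x hx => (hd x hx).differentiableAt.differentiableWithinAt,
        h.congr fun x hx => (hd x hx).deriv⟩

theorem hasDerivAt_iterInt_cons {X : Set ℝ} (hX : IsOpen X) (hXc : X.OrdConnected)
    (h0 : (0 : ℝ) ∈ X) {φ : ℕ → ℝ → ℂ} {a : ℕ} {l : List ℕ}
    (hφ : ∀ b ∈ a :: l, ContDiffOn ℝ ∞ (φ b) X) {x : ℝ} (hx : x ∈ X) :
    HasDerivAt (iterInt φ (a :: l)) (φ a x * iterInt φ l x) x :=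
  hasDerivAt_integral_of_continuousOn hX hXc h0
    ((hφ a (by simp)).mul (contDiffOn_iterInt hX hXc h0
      fun b hb => hφ b (by simp [hb]))).continuousOn hx

theorem iterInt_congr {X : Set ℝ} (hXc : X.OrdConnected) (h0 : (0 : ℝ) ∈ X) {φ ψ : ℕ → ℝ → ℂ}
    {l : List ℕ} (h : ∀ a ∈ l, ∀ x ∈ X, φ a x = ψ a x) {x : ℝ} (hx : x ∈ X) :
    iterInt φ l x = iterInt ψ l x := by
  induction l generalizing x with
  | nil => rfl
  | cons a l ih =>
    refine intervalIntegral.integral_congr fun t ht => ?_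
    have ht' := hXc.uIcc_subset h0 hx ht
    simp only [h a (by simp) t ht', ih (fun b hb => h b (by simp [hb])) ht']

/-- With `m k = min k (2n - k)` this turns the sequence `1, …, n, …, j` into an increasing one. -/
theorem iterInt_map (φ : ℕ → ℝ → ℂ) (m : ℕ → ℕ) (l : List ℕ) :
    iterInt φ (l.map m) = iterInt (fun k => φ (m k)) l := by
  induction l with
  | nil => rfl
  | cons a l ih => simp only [List.map_cons, iterInt, ih]

theorem seqUp_eq_map {n i : ℕ} (hi : i ≤ n) :
    seqUp i = (List.range' 1 i).map fun k => min k (2 * n - k) := by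
  refine List.ext_getElem (by simp [seqUp]) fun k h1 h2 => ?_
  simp [seqUp] at h1 ⊢
  omega

theorem seqUpDown_eq_map {n j : ℕ} (hj : 1 ≤ j) (hjn : j ≤ n) :
    seqUpDown n j = (List.range' 1 (2 * n - j)).map fun k => min k (2 * n - k) := by
  rw [show 2 * n - j = n + (n - j) by omega, ← List.range'_append_1, List.map_append, seqUpDown]
  congr 1
  · exact seqUp_eq_map le_rfl
  · refine List.ext_getElem (by simp) fun k h1 h2 => ?_
    simp at h1 ⊢
    omega

end IteratedIntegrals

/-! ### The flag of iterated integrals -/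

section Flag

/-- The iterated integral of `ψ_{i+1}, …, ψ_k`; it is `1` for `k = i` and is set to `0` for
`k < i`, so that its derivative is `ψ_{i+1}` times the integral of `ψ_{i+2}, …, ψ_k` in all
cases. -/
noncomputable def chainInt (ψ : ℕ → ℝ → ℂ) (i k : ℕ) (x : ℝ) : ℂ :=
  if k < i then 0 else iterInt ψ (List.range' (i + 1) (k - i)) x

theorem chainInt_self (ψ : ℕ → ℝ → ℂ) (i : ℕ) (x : ℝ) : chainInt ψ i i x = 1 := by
  simp [chainInt, iterInt]

theorem chainInt_of_lt {ψ : ℕ → ℝ → ℂ} {i k : ℕ} (h : k < i) (x : ℝ) : chainInt ψ i k x = 0 :=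
  if_pos h

theorem chainInt_of_gt_zero {ψ : ℕ → ℝ → ℂ} {i k : ℕ} (h : i < k) : chainInt ψ i k 0 = 0 := by
  obtain ⟨m, hm⟩ : ∃ m, k - i = m + 1 := ⟨k - i - 1, by omega⟩
  simp [chainInt, not_lt.2 h.le, hm, List.range'_succ, iterInt]

theorem hasDerivAt_chainInt {X : Set ℝ} (hX : IsOpen X) (hXc : X.OrdConnected)
    (h0 : (0 : ℝ) ∈ X) {ψ : ℕ → ℝ → ℂ} {k : ℕ}
    (hψ : ∀ j, 1 ≤ j → j ≤ k → ContDiffOn ℝ ∞ (ψ j) X) (i : ℕ) {x : ℝ} (hx : x ∈ X) :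
    HasDerivAt (chainInt ψ i k) (ψ (i + 1) x * chainInt ψ (i + 1) k x) x := by
  rcases lt_trichotomy k i with h | rfl | h
  · rw [chainInt_of_lt (by omega), mul_zero]
    exact (hasDerivAt_const x (0 : ℂ)).congr_of_eventuallyEq
      (Filter.Eventually.of_forall fun y => chainInt_of_lt h y)
  · rw [chainInt_of_lt (by omega), mul_zero]
    exact (hasDerivAt_const x (1 : ℂ)).congr_of_eventuallyEq
      (Filter.Eventually.of_forall fun y => chainInt_self ψ k y)
  · obtain ⟨m, rfl⟩ : ∃ m, k = i + 1 + m := ⟨k - i - 1, by omega⟩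
    have e1 : chainInt ψ i (i + 1 + m) =
        iterInt ψ ((i + 1) :: List.range' (i + 1 + 1) m) := by
      funext y
      rw [chainInt, if_neg (by omega), show i + 1 + m - i = m + 1 by omega, List.range'_succ]
    have e2 : chainInt ψ (i + 1) (i + 1 + m) x = iterInt ψ (List.range' (i + 1 + 1) m) x := by
      rw [chainInt, if_neg (by omega), show i + 1 + m - (i + 1) = m by omega]
    rw [e1, e2]
    refine hasDerivAt_iterInt_cons hX hXc h0 (fun b hb => hψ b ?_ ?_) hx <;>
    · simp at hb
      omega

variable {n : ℕ}

/-- The vectors `H_0, H_1, …` with `H_i' = ψ_{i+1} H_{i+1}` whose coordinates are iterated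
integrals, with the signs and the ordering of coordinates used in `leznov`; at `x = 0` they form a
symplectic basis up to order and signs. -/
noncomputable def flagVec (n : ℕ) (ψ : ℕ → ℝ → ℂ) (i : ℕ) (x : ℝ) : Idx n → ℂ :=
  Sum.elim (fun k => (-1) ^ (n - (k : ℕ)) * chainInt ψ i k x)
    (fun k => chainInt ψ i (2 * n - 1 - k) x)

theorem hasDerivAt_flagVec {X : Set ℝ} (hX : IsOpen X) (hXc : X.OrdConnected)
    (h0 : (0 : ℝ) ∈ X) {ψ : ℕ → ℝ → ℂ}
    (hψ : ∀ j, 1 ≤ j → j < 2 * n → ContDiffOn ℝ ∞ (ψ j) X) (i : ℕ) {x : ℝ} (hx : x ∈ X) :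
    HasDerivAt (flagVec n ψ i) (ψ (i + 1) x • flagVec n ψ (i + 1) x) x := by
  rw [hasDerivAt_pi]
  rintro (k | k)
  · have hk := k.2
    refine ((hasDerivAt_chainInt hX hXc h0 (k := k) (fun j h1 h2 => hψ j h1 (by omega)) i
      hx).const_mul ((-1) ^ (n - (k : ℕ)) : ℂ)).congr_deriv ?_
    simp only [flagVec, Pi.smul_apply, Sum.elim_inl, smul_eq_mul]
    ring
  · have hk := k.2
    exact hasDerivAt_chainInt hX hXc h0 (k := 2 * n - 1 - k)
      (fun j h1 h2 => hψ j h1 (by omega)) i hx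

theorem neg_one_pow_sub {n k : ℕ} (h : k ≤ n) : (-1 : ℂ) ^ (n - k) = (-1) ^ (n + k) := by
  obtain ⟨m, rfl⟩ := Nat.exists_eq_add_of_le h
  rw [Nat.add_sub_cancel_left, show k + m + k = m + 2 * k by ring, pow_add, pow_mul]
  simp

/-- By triangularity of `flagVec`, only one term contributes to these pairings. -/
theorem symp_flagVec_of_add_eq {ψ : ℕ → ℝ → ℂ} {i j : ℕ} (hij : i + j + 1 = 2 * n) (x : ℝ) :
    symp (flagVec n ψ i x) (flagVec n ψ j x) = (-1) ^ (n + i) := by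
  rw [symp_eq_sum]
  simp only [flagVec, Sum.elim_inl, Sum.elim_inr]
  by_cases hi : i < n
  · rw [Finset.sum_eq_single ⟨i, hi⟩]
    · simp only [chainInt_self, show 2 * n - 1 - i = j by omega,
        chainInt_of_lt (show i < j by omega)]
      rw [neg_one_pow_sub hi.le]
      ring
    · intro k _ hk
      have hk' : (k : ℕ) ≠ i := fun h => hk (Fin.ext h)
      have hk2 := k.2
      rw [chainInt_of_lt (show (k : ℕ) < j by omega)]
      rcases lt_or_gt_of_ne hk' with h | h
      · simp [chainInt_of_lt h]
      · simp [chainInt_of_lt (show 2 * n - 1 - (k : ℕ) < j by omega)]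
    · simp
  · rw [Finset.sum_eq_single ⟨j, by omega⟩]
    · simp only [chainInt_self, show 2 * n - 1 - j = i by omega,
        chainInt_of_lt (show j < i by omega)]
      rw [neg_one_pow_sub (by omega), show n + j = n + (2 * n - 1 - i) by omega]
      obtain ⟨m, rfl⟩ : ∃ m, i = n + m := ⟨i - n, by omega⟩
      obtain ⟨l, rfl⟩ : ∃ l, n = m + l + 1 := ⟨n - m - 1, by omega⟩
      rw [show m + l + 1 + (2 * (m + l + 1) - 1 - (m + l + 1 + m)) = (m + 1) + 2 * l by omega,
        show m + l + 1 + (m + l + 1 + m) = m + 2 * (m + l + 1) by omega,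
        pow_add _ _ (2 * l), pow_mul _ 2 l, pow_add _ _ (2 * (m + l + 1)), pow_mul _ 2 (m + l + 1)]
      simp [pow_succ]
    · intro k _ hk
      have hk' : (k : ℕ) ≠ j := fun h => hk (Fin.ext h)
      have hk2 := k.2
      rw [chainInt_of_lt (show (k : ℕ) < i by omega)]
      rcases lt_or_gt_of_ne hk' with h | h
      · simp [chainInt_of_lt h]
      · simp [chainInt_of_lt (show 2 * n - 1 - (k : ℕ) < i by omega)]
    · simp

theorem symp_flagVec_zero {ψ : ℕ → ℝ → ℂ} {i j : ℕ} (hij : i + j + 1 < 2 * n) :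
    symp (flagVec n ψ i 0) (flagVec n ψ j 0) = 0 := by
  have key : ∀ a b i j : ℕ, i + j ≠ a + b → chainInt ψ i a 0 * chainInt ψ j b 0 = 0 := by
    intro a b i j h
    rcases lt_trichotomy a i with h1 | rfl | h1
    · rw [chainInt_of_lt h1, zero_mul]
    · rcases lt_or_gt_of_ne (show b ≠ j by omega) with h2 | h2
      · rw [chainInt_of_lt h2, mul_zero]
      · rw [chainInt_of_gt_zero h2, mul_zero]
    · rw [chainInt_of_gt_zero h1, zero_mul]
  rw [symp_eq_sum]
  refine Finset.sum_eq_zero fun k _ => ?_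
  have hk := k.2
  simp only [flagVec, Sum.elim_inl, Sum.elim_inr]
  rw [mul_assoc, key _ _ _ _ (by omega), mul_left_comm, key _ _ _ _ (by omega)]
  ring

/-- If `ψ` is symmetric, the pairings of the flag vectors are constant: their derivatives are
combinations of pairings of higher total order, which cancel or vanish. -/
theorem symp_flagVec_of_add_lt {X : Set ℝ} (hX : IsOpen X) (hXc : X.OrdConnected)
    (h0 : (0 : ℝ) ∈ X) {ψ : ℕ → ℝ → ℂ}
    (hψ : ∀ j, 1 ≤ j → j < 2 * n → ContDiffOn ℝ ∞ (ψ j) X)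
    (hsym : ∀ i j, i + j = 2 * n → ∀ x ∈ X, ψ i x = ψ j x)
    {i j : ℕ} (hij : i + j + 1 < 2 * n) {x : ℝ} (hx : x ∈ X) :
    symp (flagVec n ψ i x) (flagVec n ψ j x) = 0 := by
  -- it suffices that the derivative vanishes, since the value at `0` does
  have red : ∀ i j, i + j + 1 < 2 * n →
      (∀ y ∈ X, ψ (i + 1) y * symp (flagVec n ψ (i + 1) y) (flagVec n ψ j y) +
        ψ (j + 1) y * symp (flagVec n ψ i y) (flagVec n ψ (j + 1) y) = 0) →
      ∀ x ∈ X, symp (flagVec n ψ i x) (flagVec n ψ j x) = 0 := by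
    intro i j hij hz x hx
    have hderiv : ∀ y ∈ X, HasDerivAt (fun y => symp (flagVec n ψ i y) (flagVec n ψ j y)) 0 y := by
      intro y hy
      refine (hasDerivAt_symp (hasDerivAt_flagVec hX hXc h0 hψ i hy)
        (hasDerivAt_flagVec hX hXc h0 hψ j hy)).congr_deriv ?_
      rw [symp_smul_left, symp_smul_right, hz y hy]
    rw [← symp_flagVec_zero (ψ := ψ) hij]
    exact hX.is_const_of_deriv_eq_zero hXc.isPreconnected
      (fun y hy => (hderiv y hy).differentiableAt.differentiableWithinAt)
      (fun y hy => (hderiv y hy).deriv) hx h0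
  obtain ⟨d, hd⟩ : ∃ d, i + j + 1 + (d + 1) = 2 * n := ⟨2 * n - (i + j + 1) - 1, by omega⟩
  induction d generalizing i j x with
  | zero =>
    refine red i j hij (fun y hy => ?_) x hx
    rw [symp_flagVec_of_add_eq (by omega), symp_flagVec_of_add_eq (by omega),
      hsym (i + 1) (j + 1) (by omega) y hy]
    ring
  | succ d ih =>
    refine red i j hij (fun y hy => ?_) x hx
    rw [ih (by omega) hy (by omega), ih (by omega) hy (by omega)]
    ring

theorem sum_sum_eq_zero_of_add_lt {S : ℕ → ℕ → ℂ} (hS : ∀ j k, j + k + 1 < 2 * n → S j k = 0)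
    {i l : ℕ} (hil : i + l + 1 < 2 * n) (a b : ℕ → ℂ) :
    ∑ j ∈ Finset.range (i + 1), ∑ k ∈ Finset.range (l + 1), a j * (b k * S j k) = 0 := by
  refine Finset.sum_eq_zero fun j hj => Finset.sum_eq_zero fun k hk => ?_
  simp only [Finset.mem_range] at hj hk
  rw [hS j k (by omega), mul_zero, mul_zero]

theorem sum_sum_eq_of_add_eq {S : ℕ → ℕ → ℂ} (hS : ∀ j k, j + k + 1 < 2 * n → S j k = 0)
    {i l : ℕ} (hil : i + l + 1 = 2 * n) (a b : ℕ → ℂ) :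
    ∑ j ∈ Finset.range (i + 1), ∑ k ∈ Finset.range (l + 1), a j * (b k * S j k) =
      a i * (b l * S i l) := by
  rw [Finset.sum_eq_single i, Finset.sum_eq_single l]
  · intro k hk hkl
    simp only [Finset.mem_range] at hk
    rw [hS i k (by omega), mul_zero, mul_zero]
  · simp
  · intro j hj hji
    refine Finset.sum_eq_zero fun k hk => ?_
    simp only [Finset.mem_range] at hj hk
    rw [hS j k (by omega), mul_zero, mul_zero]
  · simp

/-- The pairings entering the definition of a `C_n`-vector, for a vector `q H_0` proportional to the
first flag vector. -/
theorem symp_iteratedDeriv_of_eq_smul_flagVec (hn : 1 ≤ n) {X : Set ℝ} (hX : IsOpen X)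
    (hXc : X.OrdConnected) (h0 : (0 : ℝ) ∈ X) {ψ : ℕ → ℝ → ℂ} {q : ℝ → ℂ} {F : ℝ → Idx n → ℂ}
    (hψ : ∀ j, 1 ≤ j → j < 2 * n → ContDiffOn ℝ ∞ (ψ j) X) (hq : ContDiffOn ℝ ∞ q X)
    (hF : ContDiffOn ℝ ∞ F X) (hFq : ∀ x ∈ X, F x = q x • flagVec n ψ 0 x)
    (hS : ∀ x ∈ X, ∀ j k, j + k + 1 < 2 * n → symp (flagVec n ψ j x) (flagVec n ψ k x) = 0)
    {x : ℝ} (hx : x ∈ X) :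
    (∀ i, i + 2 ≤ n → symp (iteratedDeriv i F x) (iteratedDeriv (i + 1) F x) = 0) ∧
      symp (iteratedDeriv (n - 1) F x) (iteratedDeriv n F x) =
        -((q x * ∏ k ∈ Finset.Ico 1 n, ψ k x) ^ 2 * ψ n x) := by
  have htri := exists_triangular (U := fun i => iteratedDeriv i F)
    (V := flagVec n ψ) (α := fun _ _ => 1) (β := fun i => ψ (i + 1)) (q := q)
    (N := n) hX (fun _ _ => contDiffOn_const) (fun _ _ _ _ => one_ne_zero)
    (fun i hi => hψ _ (by omega) (by omega)) hq
    (fun i _ x hx => by simpa using hasDerivAt_iteratedDeriv hX hF i hx)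
    (fun i _ x hx => hasDerivAt_flagVec hX hXc h0 hψ i hx)
    (fun x hx => by simpa using hFq x hx)
  refine ⟨fun i hi => ?_, ?_⟩
  · obtain ⟨a, -, ha, -⟩ := htri i (by omega)
    obtain ⟨b, -, hb, -⟩ := htri (i + 1) (by omega)
    rw [ha x hx, hb x hx, symp_sum_smul]
    exact sum_sum_eq_zero_of_add_lt (hS x hx) (by omega) _ _
  · obtain ⟨a, -, ha, ha1⟩ := htri (n - 1) (by omega)
    obtain ⟨b, -, hb, hb1⟩ := htri n le_rfl
    rw [ha x hx, hb x hx, symp_sum_smul, sum_sum_eq_of_add_eq (hS x hx) (by omega), ha1 x hx,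
      hb1 x hx, symp_flagVec_of_add_eq (by omega)]
    obtain ⟨m, rfl⟩ : ∃ m, n = m + 1 := ⟨n - 1, by omega⟩
    have hprod : ∏ k ∈ Finset.Ico 1 (m + 1), ψ k x = ∏ j ∈ Finset.range m, ψ (j + 1) x := by
      rw [Finset.prod_Ico_eq_prod_range]
      exact Finset.prod_congr rfl fun j _ => by rw [add_comm]
    rw [Nat.add_sub_cancel, Finset.prod_range_succ, hprod, show m + 1 + m = 2 * m + 1 by ring,
      pow_succ (-1 : ℂ), pow_mul (-1 : ℂ)]
    simp only [Finset.prod_const_one, div_one]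
    simp
    ring

end Flag

/-! ### Leznov's vectors -/

section Leznov

variable {n : ℕ}

theorem leznov_eq_flagVec (φ : ℕ → ℝ → ℂ) (r : ℝ → ℂ) (x : ℝ) :
    leznov n φ r x =
      prefactor n φ r x • flagVec n (fun k => φ (min k (2 * n - k))) 0 x := by
  funext k
  rcases k with k | k
  · have hk := k.2
    simp only [leznov, flagVec, Sum.elim_inl, Pi.smul_apply, smul_eq_mul, chainInt, not_lt_zero,
      if_false, zero_add, Nat.sub_zero]
    rw [seqUp_eq_map hk.le, iterInt_map]
    ring
  · have hk := k.2
    simp only [leznov, flagVec, Sum.elim_inr, Pi.smul_apply, smul_eq_mul, chainInt, not_lt_zero,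
      if_false, zero_add, Nat.sub_zero]
    rw [seqUpDown_eq_map (by omega) (by omega), iterInt_map,
      show 2 * n - ((k : ℕ) + 1) = 2 * n - 1 - k by omega]

/-- A continuous square root of a smooth nonvanishing function is smooth. -/
theorem IsLeznovData.sqrt_smooth (hn : 1 ≤ n) {X : Set ℝ} (hX : IsOpen X) {φ : ℕ → ℝ → ℂ}
    {r : ℝ → ℂ} (h : IsLeznovData n X φ r) : ContDiffOn ℝ ∞ r X := by
  refine contDiffOn_of_comp_eq hX (f := fun z => z ^ 2) (f' := fun z => 2 * z)
    (contDiff_id.pow 2) (fun z => by simpa using hasDerivAt_pow 2 z) h.sqrt_continuous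
    (fun x hx => ?_) h.sqrt_sq (h.smooth n hn le_rfl)
  have := h.ne_zero n hn le_rfl x hx
  rw [← h.sqrt_sq x hx] at this
  simpa using this

theorem isCnVector_leznov (hn : 1 ≤ n) {X : Set ℝ} {φ : ℕ → ℝ → ℂ} {r : ℝ → ℂ} (hX : IsOpen X)
    (hXc : X.OrdConnected) (h0 : (0 : ℝ) ∈ X) (h : IsLeznovData n X φ r) :
    IsCnVector n X (leznov n φ r) := by
  set ψ : ℕ → ℝ → ℂ := fun k => φ (min k (2 * n - k)) with hψdef
  have hψ : ∀ j, 1 ≤ j → j < 2 * n → ContDiffOn ℝ ∞ (ψ j) X := fun j h1 h2 =>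
    h.smooth _ (by omega) (by omega)
  have hψφ : ∀ k ≤ n, ψ k = φ k := fun k hk => by simp only [hψdef]; congr 1; omega
  have hr := h.sqrt_smooth hn hX
  have hr0 : ∀ x ∈ X, r x ≠ 0 := fun x hx hrx => h.ne_zero n hn le_rfl x hx (by
    rw [← h.sqrt_sq x hx, hrx]; simp)
  have hprod0 : ∀ x ∈ X, ∏ k ∈ Finset.Ico 1 n, φ k x ≠ 0 := fun x hx =>
    Finset.prod_ne_zero_iff.2 fun k hk => by
      rw [Finset.mem_Ico] at hk
      exact h.ne_zero k hk.1 hk.2.le x hx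
  have hp : ContDiffOn ℝ ∞ (prefactor n φ r) X := by
    refine contDiffOn_div_complex contDiffOn_const (ContDiffOn.mul ?_ hr)
      fun x hx => mul_ne_zero (hprod0 x hx) (hr0 x hx)
    refine contDiffOn_prod fun k hk => ?_
    rw [Finset.mem_Ico] at hk
    exact h.smooth k hk.1 hk.2.le
  have hsym : ∀ i j, i + j = 2 * n → ∀ x ∈ X, ψ i x = ψ j x := fun i j hij x _ => by
    simp only [hψdef]
    rw [show min i (2 * n - i) = min j (2 * n - j) by omega]
  have hS : ∀ x ∈ X, ∀ j k, j + k + 1 < 2 * n →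
      symp (flagVec n ψ j x) (flagVec n ψ k x) = 0 := fun x hx j k hjk =>
    symp_flagVec_of_add_lt hX hXc h0 hψ hsym hjk hx
  have hF : ContDiffOn ℝ ∞ (leznov n φ r) X := by
    have : leznov n φ r = fun x => prefactor n φ r x • flagVec n ψ 0 x :=
      funext fun x => leznov_eq_flagVec φ r x
    rw [this]
    refine hp.smul (contDiffOn_pi.2 ?_)
    rintro (k | k)
    all_goals
      have hk := k.2
      simp only [flagVec, Sum.elim_inl, Sum.elim_inr, chainInt, not_lt_zero, if_false]
    · refine contDiffOn_const.mul (contDiffOn_iterInt hX hXc h0 fun a ha => ?_)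
      simp only [List.mem_range'_1] at ha
      exact hψ a (by omega) (by omega)
    · refine contDiffOn_iterInt hX hXc h0 fun a ha => ?_
      simp only [List.mem_range'_1] at ha
      exact hψ a (by omega) (by omega)
  have hpair := fun x (hx : x ∈ X) => symp_iteratedDeriv_of_eq_smul_flagVec hn hX hXc h0 hψ hp hF
    (fun x _ => leznov_eq_flagVec φ r x) hS hx
  refine ⟨hF, fun i hi x hx => (hpair x hx).1 i hi, fun x hx => ?_⟩
  rw [(hpair x hx).2]
  have hprod : ∏ k ∈ Finset.Ico 1 n, ψ k x = ∏ k ∈ Finset.Ico 1 n, φ k x :=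
    Finset.prod_congr rfl fun k hk => by rw [hψφ k (Finset.mem_Ico.1 hk).2.le]
  rw [hprod, hψφ n le_rfl, ← h.sqrt_sq x hx, prefactor]
  have h1 := hprod0 x hx
  have h2 := hr0 x hx
  field_simp

end Leznov

/-! ### Functions with prescribed vanishing orders as iterated integrals -/

section IteratedQuotients

/-- Functions `g_0, g_1, …` vanishing at `0` to order exactly `0, 1, …` are, near `0`, a common
factor times iterated integrals: divide by `g_0`, differentiate and proceed by induction. The common
factor is `ψ s` and the integrands are `ψ (s + 1), ψ (s + 2), …`. -/
theorem exists_iterInt_of_vanishing_order {N : ℕ} {X : Set ℝ} (hX : IsOpen X) (h0 : (0 : ℝ) ∈ X)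
    {g : ℕ → ℝ → ℂ} (hg : ∀ k < N, ContDiffOn ℝ ∞ (g k) X)
    (hlt : ∀ k < N, ∀ i < k, iteratedDeriv i (g k) 0 = 0)
    (hne : ∀ k < N, iteratedDeriv k (g k) 0 ≠ 0) (s : ℕ) :
    ∃ (X' : Set ℝ) (ψ : ℕ → ℝ → ℂ), IsOpen X' ∧ X'.OrdConnected ∧ (0 : ℝ) ∈ X' ∧ X' ⊆ X ∧
      (∀ j, s ≤ j → j < s + N → ContDiffOn ℝ ∞ (ψ j) X') ∧
      (∀ j, s ≤ j → j < s + N → ∀ x ∈ X', ψ j x ≠ 0) ∧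
      ∀ k < N, ∀ x ∈ X', g k x = ψ s x * iterInt ψ (List.range' (s + 1) k) x := by
  induction N generalizing X g s with
  | zero =>
    obtain ⟨ε, hε, hball⟩ := Metric.isOpen_iff.1 hX 0 h0
    refine ⟨Metric.ball 0 ε, fun _ _ => 0, Metric.isOpen_ball,
      (convex_ball 0 ε).ordConnected, Metric.mem_ball_self hε, hball, ?_, ?_, ?_⟩
    all_goals intros; omega
  | succ N ih =>
    have hg0 : ContDiffOn ℝ ∞ (g 0) X := hg 0 (by omega)
    set X₁ : Set ℝ := X ∩ g 0 ⁻¹' {0}ᶜ with hX₁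
    have hX₁o : IsOpen X₁ := hg0.continuousOn.isOpen_inter_preimage hX isOpen_compl_singleton
    have h0X₁ : (0 : ℝ) ∈ X₁ := ⟨h0, by simpa using hne 0 (by omega)⟩
    have hg0ne : ∀ x ∈ X₁, g 0 x ≠ 0 := fun x hx => hx.2
    have hinv : ContDiffOn ℝ ∞ (fun x => (g 0 x)⁻¹) X₁ :=
      (hg0.mono Set.inter_subset_left).inv hg0ne
    let Q (k : ℕ) (x : ℝ) : ℂ := g (k + 1) x * (g 0 x)⁻¹
    have hQ : ∀ k < N, ContDiffOn ℝ ∞ (Q k) X₁ := fun k hk =>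
      ((hg (k + 1) (by omega)).mono Set.inter_subset_left).mul hinv
    have hleib : ∀ k < N, ∀ i : ℕ, iteratedDeriv i (Q k) 0 = ∑ j ∈ Finset.range (i + 1),
        i.choose j * iteratedDeriv j (g (k + 1)) 0 *
          iteratedDeriv (i - j) (fun x => (g 0 x)⁻¹) 0 := fun k hk i =>
      iteratedDeriv_fun_mul
        (((hg (k + 1) (by omega)).contDiffAt (hX.mem_nhds h0)).of_le (by exact_mod_cast le_top))
        ((hinv.contDiffAt (hX₁o.mem_nhds h0X₁)).of_le (by exact_mod_cast le_top))
    obtain ⟨X', ψ, hX', hX'c, h0X', hX'X, hψ, hψ0, hrep⟩ :=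
      ih (X := X₁) (g := fun k => deriv (Q k)) hX₁o h0X₁
      (fun k hk => ((contDiffOn_infty_iff_deriv_of_isOpen hX₁o).1 (hQ k hk)).2)
      (fun k hk i hi => by
        rw [← iteratedDeriv_succ', hleib k hk]
        refine Finset.sum_eq_zero fun j hj => ?_
        rw [Finset.mem_range] at hj
        rw [hlt (k + 1) (by omega) j (by omega), mul_zero, zero_mul])
      (fun k hk => by
        rw [← iteratedDeriv_succ', hleib k hk, Finset.sum_range_succ, Finset.sum_eq_zero]
        · simpa using ⟨hne (k + 1) (by omega), hg0ne 0 h0X₁⟩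
        · intro j hj
          rw [Finset.mem_range] at hj
          rw [hlt (k + 1) (by omega) j (by omega), mul_zero, zero_mul]) (s + 1)
    have hupd : ∀ j, s < j → Function.update ψ s (g 0) j = ψ j := fun j hj =>
      Function.update_of_ne hj.ne' _ _
    refine ⟨X', Function.update ψ s (g 0), hX', hX'c, h0X', hX'X.trans Set.inter_subset_left,
      fun j h1 h2 => ?_, fun j h1 h2 => ?_, fun k hk x hx => ?_⟩
    · rcases h1.eq_or_lt with rfl | h
      · simpa using hg0.mono (hX'X.trans Set.inter_subset_left)
      · rw [hupd j h]
        exact hψ j h (by omega)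
    · rcases h1.eq_or_lt with rfl | h
      · simpa using fun x hx => hg0ne x (hX'X hx)
      · rw [hupd j h]
        exact hψ0 j h (by omega)
    · rw [Function.update_self]
      rcases Nat.eq_zero_or_pos k with rfl | hpos
      · simp [iterInt]
      · obtain ⟨k, rfl⟩ : ∃ l, k = l + 1 := ⟨k - 1, by omega⟩
        have hk' : k < N := by omega
        have hsub := hX'c.uIcc_subset h0X' hx
        have hd := (contDiffOn_infty_iff_deriv_of_isOpen hX₁o).1 (hQ k hk')
        have hQ0 : Q k 0 = 0 := by
          have : g (k + 1) 0 = 0 := by simpa using hlt (k + 1) hk 0 (by omega)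
          simp [Q, this]
        have hftc : ∫ t in (0 : ℝ)..x, deriv (Q k) t = Q k x := by
          rw [intervalIntegral.integral_eq_sub_of_hasDerivAt (f := Q k), hQ0, sub_zero]
          · exact fun t ht => ((hd.1 t (hX'X (hsub ht))).differentiableAt
              (hX₁o.mem_nhds (hX'X (hsub ht)))).hasDerivAt
          · exact (hd.2.continuousOn.mono (hsub.trans hX'X)).intervalIntegrable
        have hint : iterInt (Function.update ψ s (g 0)) (List.range' (s + 1) (k + 1)) x = Q k x := by
          rw [iterInt_congr hX'c h0X' (ψ := ψ) (fun a ha y _ => by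
            rw [hupd a (by simp at ha; omega)]) hx, List.range'_succ, ← hftc]
          exact intervalIntegral.integral_congr fun t ht => (hrep k hk' t (hsub ht)).symm
        rw [hint]
        have := hg0ne x (hX'X hx)
        simp only [Q]
        field_simp

end IteratedQuotients

/-! ### Symplectic bases -/

section SymplecticBasis

variable {n : ℕ}

theorem J_eq_neg_Omega : Matrix.J (Fin n) ℂ = -Omega n := by
  simp [Matrix.J, Omega, Matrix.fromBlocks_neg]

theorem symp_vecMul {S : Matrix (Idx n) (Idx n) ℂ} (hS : S ∈ Matrix.symplecticGroup (Fin n) ℂ)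
    (v w : Idx n → ℂ) : symp (v ᵥ* S) (w ᵥ* S) = symp v w := by
  rw [SymplecticGroup.mem_iff, J_eq_neg_Omega, Matrix.mul_neg, Matrix.neg_mul, neg_inj] at hS
  rw [symp, ← Matrix.mulVec_transpose S w, Matrix.mulVec_mulVec, ← Matrix.dotProduct_mulVec,
    Matrix.mulVec_mulVec, ← Matrix.mul_assoc, hS, symp]

/-- The first `n` derivatives of a `C_n`-vector at a point are the first `n` rows of a symplectic
matrix: they span a Lagrangian subspace, to which a complementary Lagrangian frame is added. -/
theorem IsCnVector.exists_symplectic {X : Set ℝ} (hX : IsOpen X) {F : ℝ → Idx n → ℂ}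
    (hF : IsCnVector n X F) {x : ℝ} (hx : x ∈ X) :
    ∃ S ∈ Matrix.symplecticGroup (Fin n) ℂ,
      ∀ i : Fin n, S (Sum.inl i) = iteratedDeriv (i : ℕ) F x := by
  let V : Matrix (Fin n) (Idx n) ℂ := Matrix.of fun i => iteratedDeriv (i : ℕ) F x
  let V' : Matrix (Fin n) (Idx n) ℂ := Matrix.of fun i => iteratedDeriv (2 * n - 1 - (i : ℕ)) F x
  have hgram : ∀ (A B : Matrix (Fin n) (Idx n) ℂ) i j, (A * Omega n * Bᵀ) i j =
      symp (A i) (B j) := fun A B i j => by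
    rw [Matrix.mul_assoc, symp]
    rfl
  have hVV : V * Omega n * Vᵀ = 0 := by
    ext i j
    rw [hgram]
    exact hF.symp_eq_zero_of_add_lt hX (by omega) hx
  have hdet : IsUnit (V * Omega n * V'ᵀ).det := by
    rw [Matrix.det_of_isLowerTriangular]
    · rw [isUnit_iff_ne_zero, Finset.prod_ne_zero_iff]
      intro i _
      rw [hgram]
      have : symp (V i) (V' i) = (-1) ^ (n + (i : ℕ)) := hF.symp_of_add_eq hX (by omega) hx
      simp [this]
    · intro i j hij
      rw [hgram]
      have hij' : i < j := hij
      exact hF.symp_eq_zero_of_add_lt hX (by omega) hx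
  have hOt : (Omega n)ᵀ = -Omega n := by
    simp [Omega, Matrix.fromBlocks_transpose, Matrix.fromBlocks_neg]
  let D₀ : Matrix (Fin n) (Idx n) ℂ := ((V * Omega n * V'ᵀ)⁻¹)ᵀ * V'
  have hVD₀ : V * Omega n * D₀ᵀ = 1 := by
    simp only [D₀, Matrix.transpose_mul, Matrix.transpose_transpose, ← Matrix.mul_assoc]
    exact Matrix.mul_nonsing_inv _ hdet
  have hskew : ∀ A B : Matrix (Fin n) (Idx n) ℂ, (A * Omega n * Bᵀ)ᵀ = -(B * Omega n * Aᵀ) := by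
    intro A B
    simp only [Matrix.transpose_mul, Matrix.transpose_transpose, hOt, Matrix.mul_neg,
      Matrix.neg_mul, Matrix.mul_assoc]
  have hD₀V : D₀ * Omega n * Vᵀ = -1 := by
    rw [← neg_eq_iff_eq_neg, ← hskew, hVD₀, Matrix.transpose_one]
  set G := D₀ * Omega n * D₀ᵀ with hG
  have hGt : Gᵀ = -G := hskew _ _
  -- the correction by multiples of the rows of `V` makes the complement isotropic
  let D : Matrix (Fin n) (Idx n) ℂ := D₀ - (1 / 2 : ℂ) • (G * V)
  have hVD : V * Omega n * Dᵀ = 1 := by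
    simp only [D, Matrix.transpose_sub, Matrix.transpose_smul, Matrix.transpose_mul,
      Matrix.mul_sub, Matrix.mul_smul, ← Matrix.mul_assoc, hVD₀, hVV]
    simp
  have hDV : D * Omega n * Vᵀ = -1 := by
    rw [← neg_eq_iff_eq_neg, ← hskew, hVD, Matrix.transpose_one]
  have hDD : D * Omega n * Dᵀ = 0 := by
    have e1 : D * Omega n * Dᵀ = D * Omega n * D₀ᵀ - (1 / 2 : ℂ) • (D * Omega n * Vᵀ * Gᵀ) := by
      simp only [D, Matrix.transpose_sub, Matrix.transpose_smul, Matrix.transpose_mul,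
        Matrix.mul_sub, Matrix.mul_smul, ← Matrix.mul_assoc]
    have e2 : D * Omega n * D₀ᵀ = G - (1 / 2 : ℂ) • (G * (V * Omega n * D₀ᵀ)) := by
      simp only [D, Matrix.sub_mul, Matrix.smul_mul, ← Matrix.mul_assoc, hG]
    rw [e1, e2, hVD₀, hDV, hGt, Matrix.mul_one, Matrix.neg_mul, Matrix.one_mul, neg_neg, sub_sub,
      ← add_smul]
    norm_num
  refine ⟨Matrix.fromRows V D, ?_, fun i => rfl⟩
  rw [SymplecticGroup.mem_iff, J_eq_neg_Omega, Matrix.mul_neg, Matrix.neg_mul, neg_inj,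
    Matrix.transpose_fromRows, Matrix.fromRows_mul, Matrix.fromRows_mul_fromCols, hVV, hVD, hDV,
    hDD, Omega]

theorem IsCnVector.vecMul {X : Set ℝ} (hX : IsOpen X) {F : ℝ → Idx n → ℂ}
    (hF : IsCnVector n X F) {M : Matrix (Idx n) (Idx n) ℂ}
    (hM : ∀ v w, symp (v ᵥ* M) (w ᵥ* M) = symp v w) :
    IsCnVector n X (fun x => F x ᵥ* M) ∧
      ∀ i, ∀ x ∈ X, iteratedDeriv i (fun x => F x ᵥ* M) x = iteratedDeriv i F x ᵥ* M := by
  have hder : ∀ i, ∀ x ∈ X, iteratedDeriv i (fun x => F x ᵥ* M) x = iteratedDeriv i F x ᵥ* M := by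
    intro i x hx
    refine iteratedDeriv_eq_of_chain (U := fun i x => iteratedDeriv i F x ᵥ* M) hX
      (fun x _ => by simp) (fun i x hx => hasDerivAt_pi.2 fun k => ?_) i hx
    exact hasDerivAt_dotProduct_const (hasDerivAt_iteratedDeriv hX hF.smooth i hx) _
  refine ⟨⟨contDiffOn_pi.2 fun k => ?_, fun i hi x hx => ?_, fun x hx => ?_⟩, hder⟩
  · change ContDiffOn ℝ ∞ (fun x => ∑ l, F x l * M l k) X
    exact ContDiffOn.sum fun l _ => (contDiffOn_pi.1 hF.smooth l).mul contDiffOn_const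
  · rw [hder _ x hx, hder _ x hx, hM, hF.symp_eq_zero i hi x hx]
  · rw [hder _ x hx, hder _ x hx, hM, hF.symp_eq_neg_one x hx]

end SymplecticBasis

/-! ### Every `C_n`-vector is locally one of Leznov's vectors -/

section Generality

variable {n : ℕ}

theorem flagVec_congr {X : Set ℝ} (hXc : X.OrdConnected) (h0 : (0 : ℝ) ∈ X) {φ ψ : ℕ → ℝ → ℂ}
    (h : ∀ j, 1 ≤ j → j < 2 * n → ∀ x ∈ X, φ j x = ψ j x) {x : ℝ} (hx : x ∈ X) :
    flagVec n φ 0 x = flagVec n ψ 0 x := by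
  have hJ : ∀ k < 2 * n, chainInt φ 0 k x = chainInt ψ 0 k x := fun k hk => by
    simp only [chainInt, not_lt_zero, if_false]
    refine iterInt_congr hXc h0 (fun a ha => ?_) hx
    simp only [List.mem_range'_1] at ha
    exact h a (by omega) (by omega)
  funext k
  rcases k with k | k
  · simp only [flagVec, Sum.elim_inl, hJ k (by omega)]
  · simp only [flagVec, Sum.elim_inr, hJ (2 * n - 1 - k) (by omega)]

/-- The coordinate number `k < 2n` of a vector in the order and with the signs of `flagVec`. -/
noncomputable def flagCoord (n k : ℕ) (v : Idx n → ℂ) : ℂ :=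
  if h : k < n then (-1) ^ (n - k) * v (Sum.inl ⟨k, h⟩)
  else if h : 2 * n - 1 - k < n then v (Sum.inr ⟨2 * n - 1 - k, h⟩) else 0

theorem eq_smul_flagVec_of_flagCoord {v : Idx n → ℂ} {c : ℂ} {ψ : ℕ → ℝ → ℂ} {x : ℝ}
    (h : ∀ k < 2 * n, flagCoord n k v = c * chainInt ψ 0 k x) : v = c • flagVec n ψ 0 x := by
  funext k
  rcases k with k | k
  · have hk := h k (by omega)
    have hs : ((-1 : ℂ) ^ (n - (k : ℕ))) * (-1) ^ (n - (k : ℕ)) = 1 := by rw [← mul_pow]; simp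
    rw [flagCoord, dif_pos k.2] at hk
    simp only [flagVec, Sum.elim_inl, Pi.smul_apply, smul_eq_mul]
    rw [mul_left_comm, ← hk, ← mul_assoc, hs, one_mul]
  · have hk := h (2 * n - 1 - k) (by omega)
    have hk2 := k.2
    rw [flagCoord, dif_neg (by omega), dif_pos (by omega)] at hk
    simp only [flagVec, Sum.elim_inr, Pi.smul_apply, smul_eq_mul]
    rw [← hk]
    congr 2
    ext
    simp only
    omega

theorem hasDerivAt_flagCoord {v : ℝ → Idx n → ℂ} {v' : Idx n → ℂ} {x : ℝ} (hv : HasDerivAt v v' x)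
    (k : ℕ) : HasDerivAt (fun y => flagCoord n k (v y)) (flagCoord n k v') x := by
  rw [hasDerivAt_pi] at hv
  unfold flagCoord
  split_ifs
  · exact (hv _).const_mul _
  · exact hv _
  · exact hasDerivAt_const _ _

theorem contDiffOn_flagCoord {X : Set ℝ} {v : ℝ → Idx n → ℂ} (hv : ContDiffOn ℝ ∞ v X) (k : ℕ) :
    ContDiffOn ℝ ∞ (fun y => flagCoord n k (v y)) X := by
  rw [contDiffOn_pi] at hv
  unfold flagCoord
  split_ifs
  · exact contDiffOn_const.mul (hv _)
  · exact hv _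
  · exact contDiffOn_const

theorem symp_single_inl (i : Fin n) (v : Idx n → ℂ) :
    symp (Pi.single (Sum.inl i) 1) v = v (Sum.inr i) := by
  rw [symp_eq_sum, Finset.sum_eq_single i]
  · simp
  · intro j _ hj
    simp [hj]
  · simp

/-- A `C_n`-vector whose first `n` derivatives at `0` are the first `n` unit vectors is one of
Leznov's vectors near `0`. -/
theorem IsCnVector.exists_eq_leznov (hn : 1 ≤ n) {X : Set ℝ} (hX : IsOpen X) (h0 : (0 : ℝ) ∈ X)
    {F : ℝ → Idx n → ℂ} (hF : IsCnVector n X F)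
    (hF0 : ∀ i : Fin n, iteratedDeriv (i : ℕ) F 0 = Pi.single (Sum.inl i) 1) :
    ∃ (X' : Set ℝ) (φ : ℕ → ℝ → ℂ) (r : ℝ → ℂ), IsOpen X' ∧ X'.OrdConnected ∧ (0 : ℝ) ∈ X' ∧
      X' ⊆ X ∧ IsLeznovData n X' φ r ∧ ∀ x ∈ X', F x = leznov n φ r x := by
  have hcoord : ∀ i k, iteratedDeriv i (fun y => flagCoord n k (F y)) 0 =
      flagCoord n k (iteratedDeriv i F 0) := fun i k =>
    iteratedDeriv_eq_of_chain (U := fun i y => flagCoord n k (iteratedDeriv i F y)) hX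
      (fun x _ => by simp)
      (fun i x hx => hasDerivAt_flagCoord (hasDerivAt_iteratedDeriv hX hF.smooth i hx) k) i h0
  have hinr : ∀ k, n ≤ k → k < 2 * n → ∀ i, flagCoord n k (iteratedDeriv i F 0) =
      symp (iteratedDeriv (2 * n - 1 - k) F 0) (iteratedDeriv i F 0) := fun k h1 h2 i => by
    rw [flagCoord, dif_neg (by omega), dif_pos (by omega)]
    exact (symp_single_inl ⟨2 * n - 1 - k, by omega⟩ _).symm.trans (by rw [← hF0])
  obtain ⟨X', ψ, hX', hX'c, h0X', hX'X, hψ', hψ0', hrep⟩ := exists_iterInt_of_vanishing_order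
    (N := 2 * n) (g := fun k y => flagCoord n k (F y)) hX h0
    (fun k _ => contDiffOn_flagCoord hF.smooth k)
    (fun k hk i hi => by
      rw [hcoord]
      by_cases hkn : k < n
      · have := hF0 ⟨i, by omega⟩
        simp only at this
        rw [this, flagCoord, dif_pos hkn]
        simp [hi.ne']
      · rw [hinr k (by omega) hk]
        exact hF.symp_eq_zero_of_add_lt hX (by omega) h0)
    (fun k hk => by
      rw [hcoord]
      by_cases hkn : k < n
      · have := hF0 ⟨k, hkn⟩
        simp only at this
        rw [this, flagCoord, dif_pos hkn]
        simp
      · rw [hinr k (by omega) hk, hF.symp_of_add_eq hX (by omega) h0]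
        simp) 0
  have hψ : ∀ j, j < 2 * n → ContDiffOn ℝ ∞ (ψ j) X' := fun j hj => hψ' j (by omega) (by omega)
  have hψ0 : ∀ j, j < 2 * n → ∀ x ∈ X', ψ j x ≠ 0 := fun j hj => hψ0' j (by omega) (by omega)
  have hFψ : ∀ x ∈ X', F x = ψ 0 x • flagVec n ψ 0 x := fun x hx =>
    eq_smul_flagVec_of_flagCoord fun k hk => by
      simpa [chainInt] using hrep k hk x hx
  have hFs : ContDiffOn ℝ ∞ F X' := hF.smooth.mono hX'X
  have hderH := fun i x (hx : x ∈ X') =>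
    hasDerivAt_flagVec hX' hX'c h0X' (fun j _ hj => hψ j hj) i hx
  -- the flag vectors inherit the vanishing pairings from the derivatives of `F`
  have htri := exists_triangular (U := flagVec n ψ) (V := fun i => iteratedDeriv i F)
    (α := fun i => ψ (i + 1)) (β := fun _ _ => 1) (q := fun x => 1 / ψ 0 x) (N := 2 * n - 1) hX'
    (fun i hi => hψ _ (by omega)) (fun i hi => hψ0 _ (by omega)) (fun _ _ => contDiffOn_const)
    (contDiffOn_div_complex contDiffOn_const (hψ 0 (by omega)) (hψ0 0 (by omega)))
    (fun i _ x hx => hderH i x hx)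
    (fun i _ x hx => by simpa using hasDerivAt_iteratedDeriv hX' hFs i hx)
    (fun x hx => by
      have := hψ0 0 (by omega) x hx
      simp [hFψ x hx, smul_smul, this])
  have hS : ∀ x ∈ X', ∀ j k, j + k + 1 < 2 * n →
      symp (flagVec n ψ j x) (flagVec n ψ k x) = 0 := fun x hx j k hjk => by
    obtain ⟨a, -, ha, -⟩ := htri j (by omega)
    obtain ⟨b, -, hb, -⟩ := htri k (by omega)
    rw [ha x hx, hb x hx, symp_sum_smul]
    exact sum_sum_eq_zero_of_add_lt
      (fun j k h => hF.symp_eq_zero_of_add_lt hX h (hX'X hx)) hjk _ _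
  -- differentiating the vanishing pairings of maximal order shows that `ψ` is symmetric
  have hsym : ∀ i j, i + j + 2 = 2 * n → ∀ x ∈ X', ψ (i + 1) x = ψ (j + 1) x := by
    intro i j hij x hx
    have h1 := hasDerivAt_symp (hderH i x hx) (hderH j x hx)
    have h2 : HasDerivAt (fun y => symp (flagVec n ψ i y) (flagVec n ψ j y)) 0 x := by
      refine (hasDerivAt_const x (0 : ℂ)).congr_of_eventuallyEq ?_
      filter_upwards [hX'.mem_nhds hx] with y hy using hS y hy i j (by omega)
    have h3 := h1.unique h2
    rw [symp_smul_left, symp_smul_right, symp_flagVec_of_add_eq (by omega),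
      symp_flagVec_of_add_eq (by omega), ← add_assoc, pow_succ] at h3
    have hs : ((-1 : ℂ) ^ (n + i)) ≠ 0 := by simp
    refine mul_right_cancel₀ hs ?_
    linear_combination -h3
  have hpair := fun x (hx : x ∈ X') => (symp_iteratedDeriv_of_eq_smul_flagVec hn hX' hX'c h0X'
    (fun j _ hj => hψ j hj) (hψ 0 (by omega)) hFs hFψ hS hx).2
  have hprod0 : ∀ x ∈ X', ∏ k ∈ Finset.Ico 1 n, ψ k x ≠ 0 := fun x hx =>
    Finset.prod_ne_zero_iff.2 fun k hk => by
      rw [Finset.mem_Ico] at hk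
      exact hψ0 k (by omega) x hx
  have hprodc : ContDiffOn ℝ ∞ (fun x => ∏ k ∈ Finset.Ico 1 n, ψ k x) X' :=
    contDiffOn_prod fun k hk => by
      rw [Finset.mem_Ico] at hk
      exact hψ k (by omega)
  -- the square root is chosen so that the prefactor becomes `ψ 0`
  refine ⟨X', ψ, fun x => 1 / (ψ 0 x * ∏ k ∈ Finset.Ico 1 n, ψ k x), hX', hX'c, h0X', hX'X,
    ⟨fun k _ hk => hψ k (by omega), fun k _ hk => hψ0 k (by omega), ?_, fun x hx => ?_⟩,
    fun x hx => ?_⟩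
  · exact (contDiffOn_div_complex contDiffOn_const ((hψ 0 (by omega)).mul hprodc)
      fun x hx => mul_ne_zero (hψ0 0 (by omega) x hx) (hprod0 x hx)).continuousOn
  · have h1 := hpair x hx
    rw [hF.symp_eq_neg_one x (hX'X hx), neg_inj] at h1
    have h2 := mul_ne_zero (hψ0 0 (by omega) x hx) (hprod0 x hx)
    rw [div_pow, one_pow, div_eq_iff (pow_ne_zero 2 h2), mul_comm]
    exact h1
  · have h1 := hprod0 x hx
    have h2 := hψ0 0 (by omega) x hx
    rw [hFψ x hx, leznov_eq_flagVec]
    congr 1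
    · rw [prefactor]
      field_simp
    · refine flagVec_congr hX'c h0X' (fun j hj1 hj2 y hy => ?_) hx
      rcases le_total j n with h | h
      · rw [min_eq_left (by omega)]
      · rw [min_eq_right (by omega)]
        have := hsym (j - 1) (2 * n - j - 1) (by omega) y hy
        rwa [show j - 1 + 1 = j by omega, show 2 * n - j - 1 + 1 = 2 * n - j by omega] at this

theorem IsCnVector.exists_eq_leznov_vecMul (hn : 1 ≤ n) {X : Set ℝ} (hX : IsOpen X)
    (h0 : (0 : ℝ) ∈ X) {F : ℝ → Idx n → ℂ} (hF : IsCnVector n X F) :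
    ∃ (X' : Set ℝ) (φ : ℕ → ℝ → ℂ) (r : ℝ → ℂ), ∃ S ∈ Matrix.symplecticGroup (Fin n) ℂ,
      IsOpen X' ∧ X'.OrdConnected ∧ (0 : ℝ) ∈ X' ∧ X' ⊆ X ∧ IsLeznovData n X' φ r ∧
      ∀ x ∈ X', F x = leznov n φ r x ᵥ* S := by
  obtain ⟨S, hS, hSF⟩ := hF.exists_symplectic hX h0
  have hunit : IsUnit S.det := SymplecticGroup.symplectic_det hS
  have hcancel : ∀ v : Idx n → ℂ, v ᵥ* S⁻¹ ᵥ* S = v := fun v => by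
    rw [Matrix.vecMul_vecMul, Matrix.nonsing_inv_mul _ hunit, Matrix.vecMul_one]
  obtain ⟨hF', hder⟩ := hF.vecMul hX (M := S⁻¹) fun v w => by
    rw [← symp_vecMul hS, hcancel, hcancel]
  obtain ⟨X', φ, r, h1, h2, h3, h4, h5, h6⟩ := hF'.exists_eq_leznov hn hX h0 fun i => by
    rw [hder _ 0 h0, ← hSF]
    have : S (Sum.inl i) = Pi.single (Sum.inl i) 1 ᵥ* S := by simp [Matrix.row]
    rw [this, Matrix.vecMul_vecMul, Matrix.mul_nonsing_inv _ hunit, Matrix.vecMul_one]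
  exact ⟨X', φ, r, S, hS, h1, h2, h3, h4, h5, fun x hx => by rw [← h6 x hx, hcancel]⟩

end Generality

end CnToda

theorem theorem2 (n : ℕ) (hn : 1 ≤ n) :
    -- Part (1): solutions of the Toda field equations of type C_n
    (∀ (X Y : Set ℝ) (F G : ℝ → CnToda.Idx n → ℂ), IsOpen X → IsOpen Y →
      CnToda.IsCnVector n X F → CnToda.IsCnVector n Y G →
      ∀ (W : Set (ℝ × ℝ)) (u : Fin n → ℝ → ℝ → ℂ), IsOpen W → W ⊆ X ×ˢ Y →
        (∀ i : Fin n, CnToda.IsNegLog W (u i) (CnToda.tau F G ((i : ℕ) + 1))) →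
        CnToda.IsTodaSolution (CartanMatrix.C n) W u) ∧
    -- Part (2): Leznov's vectors satisfy the conditions
    (∀ (X : Set ℝ) (φ : ℕ → ℝ → ℂ) (r : ℝ → ℂ), IsOpen X → X.OrdConnected → (0 : ℝ) ∈ X →
      CnToda.IsLeznovData n X φ r →
      CnToda.IsCnVector n X (CnToda.leznov n φ r)) ∧
    -- and they are the most general ones, locally and up to a constant symplectic matrix
    (∀ (X : Set ℝ) (F : ℝ → CnToda.Idx n → ℂ), IsOpen X → (0 : ℝ) ∈ X →
      CnToda.IsCnVector n X F →
      ∃ (X' : Set ℝ) (φ : ℕ → ℝ → ℂ) (r : ℝ → ℂ),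
        ∃ S ∈ Matrix.symplecticGroup (Fin n) ℂ,
          IsOpen X' ∧ X'.OrdConnected ∧ (0 : ℝ) ∈ X' ∧ X' ⊆ X ∧
          CnToda.IsLeznovData n X' φ r ∧
          ∀ x ∈ X', F x = Matrix.vecMul (CnToda.leznov n φ r x) S) := by
  exact ⟨fun _ _ _ _ hX hY hF hG _ _ hW hWXY hu =>
      CnToda.isTodaSolution_of_isCnVector hn hX hY hF hG hW hWXY hu,
    fun _ _ _ hX hXc h0 h => CnToda.isCnVector_leznov hn hX hXc h0 h,
    fun _ _ hX h0 hF => hF.exists_eq_leznov_vecMul hn hX h0⟩
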